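/- **Setting.** Consider finite two-player zero-sum extensive-form games $G$ with chance moves and perfect recall. For such a game let $S_i$ be the set of information sets of player $i$ occurring in the game tree and $|A|$ the largest number of actions at an information set; the payoff range is the largest difference of two terminal payoffs. A *population* $\Pi$ is a choice of a non-empty set of available actions at every information set; the *restricted game* $G|_\Pi$ is obtained by deleting all other actions. A joint strategy of $G|_\Pi$ is regarded as one of $G$ by giving the other actions probability $0$. A *regret minimizer* produces for every game a sequence $\sigma^1,\sigma^2,\dots$ of joint behavioural strategies. For constants $\Delta,c\in\mathbb R$, $p\in\mathbb N$ we say that it has regret $\tilde O(|S_i|\sqrt{|A|T})$ if, on all games with perfect recall and payoff range at most $\Delta$, for both players $i$ and all $T$, $$\max_{\pi}\sum_{t\le T}\bigl(v_i(\pi,\sigma^t_{-i})-v_i(\sigma^t)\bigr)\le c\,|S_i|\sqrt{|A|T}\,\bigl(1+\log(|S||A|T)\bigr)^p,\qquad |S|=\sum_i|S_i| .$$ **Regret-Minimizing Double Oracle (RMDO)** with a frequency function $m$ (a positive integer $m(j)$ for every time window $j$, which may depend on the restricted game of that window) works as follows. The first population consists of pure best responses to the uniformly random strategies. Each iteration $t=1,2,\dots$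 in window $j$ runs one more iteration of the regret minimizer in the current restricted game. If $m(j)$ divides $t$, then pure best responses of both players in $G$ against the last-window average strategy (the average, weighted by own reaching probabilities, of the strategies produced in the current window) are computed and added to the population; if this adds a new action, window $j+1$ starts and the regret minimizer is restarted from scratch. Let $S_{i,j}$ be the set of information sets of player $i$ in the restricted game of window $j$, $|A_j|$ the largest number of actions at an information set in it, and $s_j=\sum_i|S_{i,j}|$. Each iteration of the regret minimizer and each computation of best responses in window $j$ (iterations $t\ge 1$) is charged $s_j$ samples. The run *reaches* an $\varepsilon$-Nash equilibrium at the first iteration at which the last-window average strategy is an $\varepsilon$-Nash equilibrium of $G$; $k$ is the number of windows used up to then and $X=s_k$ is the size of the final restricted game. The *RMDO bound* is $$B(m)=\sum_{j=1}^{k}\Bigl(\frac{|A_j|s_j^3}{\varepsilon^2m(j)}+\frac{|A_j|s_j^3}{\varepsilon^2}+s_j\,m(j)\Bigr).$$ **AdaDO** is RMDO with the adaptive frequency $m^*(j)=\sqrt{|A_j|}\,\sum_i|S_{i,j}|/\varepsilon$, rounded up to a positive integer. **Proposition.** 1. For all $\Delta,c,p$ there is a constant $C>0$ such that, for every regret minimizer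 with regret $\tilde O(|S_i|\sqrt{|A|T})$ with these constants, every game $G$ with perfect recall and payoff range at most $\Delta$, every choice of the pure best responses and every $0<\varepsilon\le1$: - for every frequency function $m$, RMDO reaches an $\varepsilon$-Nash equilibrium, after at most $C\,(1+\log(|A|X/\varepsilon))^{2p}\,B(m)$ samples; - AdaDO reaches an $\varepsilon$-Nash equilibrium, after at most $C\,(1+\log(|A|X/\varepsilon))^{2p}\,B(m^*)$ samples, and after at most $$C\,\bigl(1+\log(|A|X/\varepsilon)\bigr)^{2p}\Bigl(\frac{k|A|X^3}{\varepsilon^2}+\frac{2k\sqrt{|A|}X^2}{\varepsilon}\Bigr)$$ samples, that is, its sample complexity is $\tilde O\bigl(k|A|X^3/\varepsilon^2+2k\sqrt{|A|}X^2/\varepsilon\bigr)$. (The quantities $k$, $X$, $|A_j|$, $S_{i,j}$ are those of the respective run. By convention $\log 0=0$ if the game has no information sets.) 2. Counterfactual regret minimization with regret matching is such a regret minimizer, with $c=\Delta$ and $p=0$, for every $\Delta$. 3. For every game $G$, every $\varepsilon>0$ and all populations $\Pi_1,\dots,\Pi_k$ contained in $\Pi_k$, with $|A_j|$, $s_j$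 formed for $G|_{\Pi_j}$ and $X=s_k$, the adaptive frequency minimizes the RMDO bound: $B(m^*)\le B(m)$ for all positive real $m(1),\dots,m(k)$, and $$B(m^*)=\sum_{j=1}^k\Bigl(\frac{|A_j|s_j^3}{\varepsilon^2}+\frac{2\sqrt{|A_j|}s_j^2}{\varepsilon}\Bigr)\le\frac{k|A|X^3}{\varepsilon^2}+\frac{2k\sqrt{|A|}X^2}{\varepsilon}.$$ The right-hand side is the least value, over all positive real $m(1),\dots,m(k)$, of the coarser RMDO bound $$\frac{k|A|X^3}{\varepsilon^2}+\sum_{j=1}^k\Bigl(\frac{|A|X^3}{\varepsilon^2m(j)}+X\,m(j)\Bigr).$$ (If $s_j=0$, then $m^*(j)=0$, and the summand of index $j$ in $B(m^*)$ is read as $0$.) -/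

import Mathlib

universe u

noncomputable section

/-- Finite game trees of two-player zero-sum extensive-form games. A decision node carries the
information set `s` it belongs to, and has one child for each action available at `s`. A leaf
carries the payoff of player `0`; player `1` receives its negative. -/
inductive GameTree (Info : Type u) (Act : Info → Type u) : Type u
  | leaf (payoff : ℝ) : GameTree Info Act
  | chance (n : ℕ) (p : stdSimplex ℝ (Fin n)) (next : Fin n → GameTree Info Act) :
      GameTree Info Act
  | decision (s : Info) (next : Act s → GameTree Info Act) : GameTree Info Act

namespace GameTree

variable {Info : Type u} {Act : Info → Type u}

/-- The payoffs of player `0` at the terminal histories. -/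
def payoffs : GameTree Info Act → Set ℝ
  | leaf u => {u}
  | chance _ _ next => ⋃ c, (next c).payoffs
  | decision _ next => ⋃ a, (next a).payoffs

open Classical in
/-- The information sets that occur in the tree. -/
def infosets [∀ s, Fintype (Act s)] : GameTree Info Act → Finset Info
  | leaf _ => ∅
  | chance _ _ next => Finset.univ.biUnion fun c => (next c).infosets
  | decision s next => insert s (Finset.univ.biUnion fun a => (next a).infosets)

/-- `past i` is the sequence of own information sets and own actions that player `i` has gone
through above the current node; the predicate says that at every node below, belonging to an
information set `s`, the sequence of the player to move is `own s`. -/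
def RecallFrom (player : Info → Fin 2) (own : Info → List (Σ s, Act s)) :
    (Fin 2 → List (Σ s, Act s)) → GameTree Info Act → Prop
  | _, leaf _ => True
  | past, chance _ _ next => ∀ c, RecallFrom player own past (next c)
  | past, decision s next => own s = past (player s) ∧
      ∀ a, RecallFrom player own
        (Function.update past (player s) (past (player s) ++ [⟨s, a⟩])) (next a)

/-- Expected payoff of player `i` from the root of the tree on, under the joint behavioural
strategy `σ`. -/
def value [∀ s, Fintype (Act s)] (σ : ∀ s, stdSimplex ℝ (Act s)) (i : Fin 2) :
    GameTree Info Act → ℝ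
  | leaf u => if i = 0 then u else -u
  | chance _ p next => ∑ c, p.1 c * (next c).value σ i
  | decision s next => ∑ a, (σ s).1 a * (next a).value σ i

open Classical in
/-- `∑ h ∈ s, x_i(h)`, where `x_i(h)` is the contribution of player `i` under `σ` to the
probability of reaching the node `h`. -/
def ownReach [∀ s, Fintype (Act s)] (player : Info → Fin 2) (σ : ∀ s, stdSimplex ℝ (Act s))
    (i : Fin 2) (s : Info) : GameTree Info Act → ℝ
  | leaf _ => 0
  | chance _ _ next => ∑ c, (next c).ownReach player σ i s
  | decision s' next => (if s' = s then 1 else 0) +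
      ∑ a, (if player s' = i then (σ s').1 a else 1) * (next a).ownReach player σ i s

open Classical in
/-- Instantaneous counterfactual regrets of player `i` under `σ`: for an information set `s` of
player `i` and an action `a` at `s` this is `∑ h ∈ s, x_{-i}(h) * (v_i(h·a) - v_i(h))`, where
`x_{-i}(h)` is the contribution of chance and of the opponent to the probability of reaching
`h`. -/
def cfRegret [∀ s, Fintype (Act s)] (player : Info → Fin 2) (σ : ∀ s, stdSimplex ℝ (Act s))
    (i : Fin 2) : GameTree Info Act → ∀ s, Act s → ℝ
  | leaf _ => 0
  | chance _ p next => ∑ c, p.1 c • (next c).cfRegret player σ i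
  | decision s' next =>
      if player s' = i then
        Pi.single s' (fun a => (next a).value σ i - (decision s' next).value σ i) +
          ∑ a, (next a).cfRegret player σ i
      else ∑ a, (σ s').1 a • (next a).cfRegret player σ i

open Classical in
/-- Removal of all branches whose action is not in `R`. -/
def restrict (R : ∀ s, Finset (Act s)) :
    GameTree Info Act → GameTree Info (fun s => {a : Act s // a ∈ R s})
  | leaf u => leaf u
  | chance n p next => chance n p fun c => (next c).restrict R
  | decision s next => decision s fun a => (next a.1).restrict R

theorem ownReach_nonneg [∀ s, Fintype (Act s)] (player : Info → Fin 2)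
    (σ : ∀ s, stdSimplex ℝ (Act s)) (i : Fin 2) (s : Info) (t : GameTree Info Act) :
    0 ≤ t.ownReach player σ i s := by
  induction t with
  | leaf u => simp [ownReach]
  | chance n p next ih => exact Finset.sum_nonneg fun c _ => ih c
  | decision s' next ih =>
    refine add_nonneg (by split_ifs <;> norm_num) (Finset.sum_nonneg fun a _ => ?_)
    refine mul_nonneg ?_ (ih a)
    split_ifs
    · exact (σ s').2.1 a
    · norm_num

end GameTree

/-- A finite two-player zero-sum extensive-form game with chance moves. -/
structure EFGame where
  Info : Type u
  player : Info → Fin 2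
  Act : Info → Type u
  [finInfo : Finite Info]
  [fintypeAct : ∀ s, Fintype (Act s)]
  [nonemptyAct : ∀ s, Nonempty (Act s)]
  root : GameTree Info Act

namespace EFGame

attribute [instance] finInfo fintypeAct nonemptyAct

variable (G : EFGame.{u})

/-- All nodes of an information set have the same sequence of information sets and actions of the
player who moves there. -/
def PerfectRecall : Prop :=
  ∃ own : G.Info → List (Σ s, G.Act s), G.root.RecallFrom G.player own fun _ => []

/-- The payoff range is at most `Δ`. -/
def PayoffRangeLE (Δ : ℝ) : Prop :=
  ∀ u ∈ G.root.payoffs, ∀ u' ∈ G.root.payoffs, u - u' ≤ Δ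

open Classical in
/-- `|S_i|`. -/
def numInfosets (i : Fin 2) : ℕ := (G.root.infosets.filter fun s => G.player s = i).card

/-- `∑ i, |S_i|`, the size of the game. -/
def size : ℕ := ∑ i, G.numInfosets i

/-- `|A|`, the largest number of actions at an information set. -/
def maxActions : ℕ := G.root.infosets.sup fun s => Fintype.card (G.Act s)

/-- Joint behavioural strategies. The strategy of player `i` is the restriction to the information
sets of player `i`. -/
abbrev Profile : Type u := ∀ s, stdSimplex ℝ (G.Act s)

/-- Pure strategies of both players. -/
abbrev PureProfile : Type u := ∀ s, G.Act s

variable {G}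

/-- Expected payoff of player `i`. -/
def value (i : Fin 2) (σ : G.Profile) : ℝ := G.root.value σ i

/-- Player `i` plays according to `π` and the opponent according to `σ`. -/
def deviate (i : Fin 2) (π σ : G.Profile) : G.Profile := fun s => if G.player s = i then π s else σ s

/-- `ε`-Nash equilibria. -/
def IsEpsNash (ε : ℝ) (σ : G.Profile) : Prop :=
  ∀ (i : Fin 2) (π : G.Profile), value i (deviate i π σ) ≤ value i σ + ε

open Classical in
/-- A pure strategy as a behavioural strategy. -/
def PureProfile.toProfile (b : G.PureProfile) : G.Profile := fun s =>
  ⟨Pi.single (b s) 1, single_mem_stdSimplex ℝ (b s)⟩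

/-- The strategies of both players in `b` are best responses to the strategies of the opponents
in `σ`. -/
def IsBestResponse (σ : G.Profile) (b : G.PureProfile) : Prop :=
  ∀ (i : Fin 2) (π : G.Profile), value i (deviate i π σ) ≤ value i (deviate i b.toProfile σ)

theorem uniform_mem (s : G.Info) :
    (fun _ => 1 / (Fintype.card (G.Act s) : ℝ)) ∈ stdSimplex ℝ (G.Act s) := by
  refine ⟨fun _ => by positivity, ?_⟩
  have : (Fintype.card (G.Act s) : ℝ) ≠ 0 := by exact_mod_cast Fintype.card_ne_zero
  simp [this]

/-- The uniformly random strategies. -/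
def uniform : G.Profile := fun s => ⟨_, uniform_mem s⟩

/-- `∑ t < T, v_i(π, σ_{-i}^t) - v_i(σ^t)`. The cumulative regret of player `i` is the maximum of
this over `π`. -/
def regretAgainst (σ : ℕ → G.Profile) (i : Fin 2) (T : ℕ) (π : G.Profile) : ℝ :=
  ∑ t ∈ Finset.range T, (value i (deviate i π (σ t)) - value i (σ t))

/-- The weight `∑ h ∈ s, x_i(h)` of the information set `s` of player `i` under `σ`; with perfect
recall all summands are equal to the probability with which player `i` plays towards `s`. -/
def reachWeight (σ : G.Profile) (s : G.Info) : ℝ := G.root.ownReach G.player σ (G.player s) s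

/-- The average `∑ t < T, x_i^t(s) σ^t(s, a) / ∑ t < T, x_i^t(s)` of the strategies
`σ 0, …, σ (T - 1)`, uniform where the denominator vanishes. -/
def average (σ : ℕ → G.Profile) (T : ℕ) : G.Profile := fun s =>
  if h : 0 < ∑ t ∈ Finset.range T, reachWeight (σ t) s then
    ⟨fun a => (∑ t ∈ Finset.range T, reachWeight (σ t) s * (σ t s).1 a) /
        ∑ t ∈ Finset.range T, reachWeight (σ t) s, by
      refine ⟨fun a => div_nonneg (Finset.sum_nonneg fun t _ =>
        mul_nonneg (GameTree.ownReach_nonneg _ _ _ _ _) ((σ t s).2.1 a)) h.le, ?_⟩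
      rw [← Finset.sum_div, Finset.sum_comm, div_eq_one_iff_eq h.ne']
      refine Finset.sum_congr rfl fun t _ => ?_
      rw [← Finset.mul_sum, (σ t s).2.2, mul_one]⟩
  else uniform s

/-- Regret matching: probabilities proportional to the positive parts of the regrets, and uniform
if there is no positive regret. -/
def regretMatching (Q : ∀ s, G.Act s → ℝ) : G.Profile := fun s =>
  if h : 0 < ∑ a, max 0 (Q s a) then
    ⟨fun a => max 0 (Q s a) / ∑ a, max 0 (Q s a), by
      refine ⟨fun a => div_nonneg (le_max_left _ _) h.le, ?_⟩
      rw [← Finset.sum_div, div_self h.ne']⟩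
  else uniform s

variable (G) in
/-- Cumulative counterfactual regrets after `n` iterations of counterfactual regret minimization
(all players update simultaneously, by regret matching). -/
def cfrRegrets : ℕ → ∀ s, G.Act s → ℝ
  | 0 => 0
  | n + 1 => fun s a => cfrRegrets n s a +
      G.root.cfRegret G.player (regretMatching (cfrRegrets n)) (G.player s) s a

/-- Nonempty sets of available actions at all information sets. -/
abbrev Population (G : EFGame.{u}) : Type u := ∀ s, {A : Finset (G.Act s) // A.Nonempty}

/-- The restricted game, in which only the actions of the population are available. -/
def restrict (G : EFGame.{u}) (R : G.Population) : EFGame.{u} where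
  Info := G.Info
  player := G.player
  Act := fun s => {a : G.Act s // a ∈ (R s).1}
  fintypeAct := fun _ => inferInstance
  nonemptyAct := fun s => (R s).2.to_subtype
  root := G.root.restrict fun s => (R s).1

open Classical in
/-- A joint strategy of the restricted game as one of the original game: the actions outside the
population get probability zero. -/
def expand (R : G.Population) (σ : (G.restrict R).Profile) : G.Profile := fun s =>
  ⟨fun a => if h : a ∈ (R s).1 then (σ s).1 ⟨a, h⟩ else 0, by
    refine ⟨fun a => ?_, ?_⟩
    · dsimp only
      split_ifs with h
      · exact (σ s).2.1 ⟨a, h⟩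
      · exact le_rfl
    · have h1 : ∑ a : {a : G.Act s // a ∈ (R s).1}, (σ s).1 a = 1 := (σ s).2.2
      rw [← h1, ← Finset.sum_subset (Finset.subset_univ (R s).1) (fun a _ h => dif_neg h),
        ← Finset.sum_attach]
      exact Finset.sum_congr rfl fun a _ => dif_pos a.2⟩

/-- The population that consists of a single pure strategy per player. -/
def Population.single (b : G.PureProfile) : G.Population := fun s =>
  ⟨{b s}, Finset.singleton_nonempty _⟩

open Classical in
/-- The population enlarged by the actions of the pure strategies `b`. -/
def Population.add (R : G.Population) (b : G.PureProfile) : G.Population := fun s =>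
  ⟨insert (b s) (R s).1, Finset.insert_nonempty _ _⟩

/-- A frequency function: number of iterations between best-response computations in the `j`-th
time window, which may also take into account the restricted game of that window. -/
abbrev FrequencyFunction (G : EFGame.{u}) : Type u := ℕ → G.Population → ℕ+

/-- `√|A_j| * ∑ i, |S_{i,j}| / ε` for the restricted game given by `R`. -/
def adaptiveFrequency (ε : ℝ) (R : G.Population) : ℝ :=
  √((G.restrict R).maxActions : ℝ) * (G.restrict R).size / ε

/-- The frequency function of Adaptive Double Oracle: the adaptive frequency rounded up to a
positive integer. -/
def adaDO (ε : ℝ) : G.FrequencyFunction := fun _ R => (⌈adaptiveFrequency ε R⌉₊).toPNat'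

end EFGame

/-- An iterative self-play algorithm: for every game the sequence of joint strategies that it
produces when started from scratch. -/
abbrev SelfPlay : Type (u + 1) := ∀ G : EFGame.{u}, ℕ → G.Profile

/-- Counterfactual regret minimization with regret matching. -/
def cfr : SelfPlay.{u} := fun G n => EFGame.regretMatching (G.cfrRegrets n)

/-- On all games with perfect recall and payoff range at most `Δ`, the cumulative regret of either
player after `T` iterations is at most
`c * |S_i| * √(|A| * T) * (1 + log (|S| * |A| * T)) ^ p`. -/
def SelfPlay.HasRegretBound (alg : SelfPlay.{u}) (Δ c : ℝ) (p : ℕ) : Prop :=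
  ∀ G : EFGame.{u}, G.PerfectRecall → G.PayoffRangeLE Δ →
    ∀ (i : Fin 2) (T : ℕ) (π : G.Profile),
      EFGame.regretAgainst (alg G) i T π ≤
        c * G.numInfosets i * √((G.maxActions : ℝ) * T) *
          (1 + Real.log ((G.size : ℝ) * G.maxActions * T)) ^ p

namespace EFGame

/-- The state of Regret-Minimizing Double Oracle between two iterations. -/
structure RMDOState (G : EFGame.{u}) where
  /-- index of the current time window, starting from `0` -/
  window : ℕ
  /-- current population -/
  pop : G.Population
  /-- number of iterations already made in the current window -/
  len : ℕ
  /-- number of samples used so far -/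
  samples : ℕ

variable {G : EFGame.{u}}

/-- The last-window average strategy, as a strategy of the original game, at the iteration that
starts from the state `st` (the strategy produced in this iteration is included). -/
def RMDOState.lastWindowAverage (alg : SelfPlay.{u}) (st : RMDOState G) : G.Profile :=
  expand st.pop (average (alg (G.restrict st.pop)) (st.len + 1))

open Classical in
/-- Iteration number `t` of Regret-Minimizing Double Oracle. One iteration of the regret minimizer
in the restricted game costs `∑ i, |S_{i,j}|` samples, and so does the computation of best
responses, which takes place if the frequency divides `t`. If the best responses contain a new
action, a new window is opened and the regret minimizer is started anew. -/
def RMDOState.step (alg : SelfPlay.{u}) (br : G.Profile → G.PureProfile)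
    (m : G.FrequencyFunction) (t : ℕ) (st : RMDOState G) : RMDOState G :=
  if t % (m st.window st.pop : ℕ) = 0 then
    if st.pop.add (br (st.lastWindowAverage alg)) = st.pop then
      ⟨st.window, st.pop, st.len + 1, st.samples + 2 * (G.restrict st.pop).size⟩
    else
      ⟨st.window + 1, st.pop.add (br (st.lastWindowAverage alg)), 0,
        st.samples + 2 * (G.restrict st.pop).size⟩
  else ⟨st.window, st.pop, st.len + 1, st.samples + (G.restrict st.pop).size⟩

/-- The state of Regret-Minimizing Double Oracle with regret minimizer `alg`, best-response oracle
`br` and frequency function `m` after `t` iterations. -/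
def rmdo (alg : SelfPlay.{u}) (br : G.Profile → G.PureProfile) (m : G.FrequencyFunction) :
    ℕ → RMDOState G
  | 0 => ⟨0, .single (br uniform), 0, 0⟩
  | t + 1 => (rmdo alg br m t).step alg br m (t + 1)

/-- Iteration `t + 1` is the first one at which the last-window average strategy is an `ε`-Nash
equilibrium of the original game. -/
def ReachesAt (alg : SelfPlay.{u}) (br : G.Profile → G.PureProfile) (m : G.FrequencyFunction)
    (ε : ℝ) (t : ℕ) : Prop :=
  IsLeast {t : ℕ | IsEpsNash ε ((rmdo alg br m t).lastWindowAverage alg)} t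

/-- The population of the `j`-th window of the run. -/
def windowPop (alg : SelfPlay.{u}) (br : G.Profile → G.PureProfile) (m : G.FrequencyFunction)
    (j : ℕ) : G.Population :=
  (rmdo alg br m (sInf {t : ℕ | (rmdo alg br m t).window = j})).pop

/-- The sample complexity bound of Regret-Minimizing Double Oracle with windows `0, …, k - 1`,
populations `R j` and frequencies `m j`, that is
`∑ j < k, (|A_j| s_j ^ 3 / (ε ^ 2 * m j) + |A_j| s_j ^ 3 / ε ^ 2 + s_j * m j)` with
`s_j = ∑ i, |S_{i,j}|`. -/
def rmdoBound (ε : ℝ) (k : ℕ) (R : ℕ → G.Population) (m : ℕ → ℝ) : ℝ :=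
  ∑ j ∈ Finset.range k,
    (((G.restrict (R j)).maxActions : ℝ) * (G.restrict (R j)).size ^ 3 / (ε ^ 2 * m j) +
      ((G.restrict (R j)).maxActions : ℝ) * (G.restrict (R j)).size ^ 3 / ε ^ 2 +
      ((G.restrict (R j)).size : ℝ) * m j)

end EFGame

/-- `k |A| X³ / ε² + ∑ j < k, (|A| X³ / (ε² m j) + X m j)`. -/
def rmdoUniformBound (ε : ℝ) (k A X : ℕ) (m : ℕ → ℝ) : ℝ :=
  k * A * X ^ 3 / ε ^ 2 +
    ∑ j ∈ Finset.range k, ((A : ℝ) * X ^ 3 / (ε ^ 2 * m j) + X * m j)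

/-- `k |A| X³ / ε² + 2 k √|A| X² / ε`. -/
def adaDOBound (ε : ℝ) (k A X : ℕ) : ℝ :=
  k * A * X ^ 3 / ε ^ 2 + 2 * k * √(A : ℝ) * X ^ 2 / ε

end

/-!
The theorem combines four facts.

*Optimality of the frequency.* The sum of the two terms of the bound that depend on `m j` exceeds
`2 √|A_j| s_j² / ε` by a nonnegative multiple of `(√|A_j| s_j / ε - m j)²` (`le_div_add_mul`), and the
adaptive frequency attains equality (`div_add_mul_adaptive`).

*Counterfactual regret minimization.* With perfect recall, the regret against a deviation `π` is the
sum over the information sets of the player of the counterfactual regrets, averaged by `π` over the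
actions and weighted by reaching probabilities under `π`
(`GameTree.RecallFrom.pathProb_mul_value_sub`). Each instantaneous counterfactual regret is bounded
by the payoff range (`GameTree.RecallFrom.abs_cfRegret_le`), and regret matching keeps the square
sum of the positive parts of the cumulative ones linear in the number of iterations
(`EFGame.sum_sq_max_zero_cfrRegrets_le`).

*Averages are equilibria.* With perfect recall the payoff is linear in the average strategy against
a fixed opponent (`GameTree.RecallFrom.sum_pathProb_mul_value`), so that, the game being zero-sum,
the average strategy is an equilibrium up to the sum of the average regrets
(`EFGame.isEpsNash_average`). Under the assumed regret bound,
`N_j = K |A_j| s_j² (1 + log (|A| X / ε)) ^ (2 p) / ε²` iterations give an `ε`-equilibrium of the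
restricted game of window `j`, for a constant `K` depending on `c` and `p` only
(`exists_regret_le_mul`).

*Length of the windows.* If best responses to an `ε`-equilibrium of the restricted game add no new
action, then it is an `ε`-equilibrium of the whole game (`EFGame.IsEpsNash.expand`). Hence, until
such an equilibrium is reached, a window is closed by the first best-response computation after
`N_j` iterations (`EFGame.len_le`). It thus has at most about `N_j + m j` iterations and
`N_j / m j + 2` best-response computations, each charged `s_j` samples, which is the summand of the
bound for window `j`. The run ends because every new window makes another action available
(`EFGame.exists_reachesAt`).
-/

/-! ### Paths, perfect recall and values in game trees -/

namespace GameTree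

variable {Info : Type u} {Act : Info → Type u}

/-- The probability with which the strategy `σ` takes all actions of the sequence `l`; for the
sequence of own information sets and actions above a node this is the contribution of the player
to the probability of reaching the node. -/
noncomputable def pathProb [∀ s, Fintype (Act s)] (σ : ∀ s, stdSimplex ℝ (Act s))
    (l : List (Σ s, Act s)) : ℝ :=
  (l.map fun x => (σ x.1).1 x.2).prod

/-- The number of nodes that belong to the information set `s`. -/
noncomputable def nodeCount [∀ s, Fintype (Act s)] (s : Info) : GameTree Info Act → ℝ
  | leaf _ => 0
  | chance _ _ next => ∑ c, (next c).nodeCount s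
  | decision s' next => (open Classical in if s' = s then 1 else 0) + ∑ a, (next a).nodeCount s

section Values

variable [∀ s, Fintype (Act s)]

@[simp]
theorem pathProb_nil (σ : ∀ s, stdSimplex ℝ (Act s)) : pathProb σ [] = 1 := by
  simp [pathProb]

theorem pathProb_append_singleton (σ : ∀ s, stdSimplex ℝ (Act s)) (l : List (Σ s, Act s))
    (s : Info) (a : Act s) : pathProb σ (l ++ [⟨s, a⟩]) = pathProb σ l * (σ s).1 a := by
  simp [pathProb]

theorem apply_le_one (σ : ∀ s, stdSimplex ℝ (Act s)) (s : Info) (a : Act s) : (σ s).1 a ≤ 1 := by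
  rw [← (σ s).2.2]
  exact Finset.single_le_sum (fun b _ => (σ s).2.1 b) (Finset.mem_univ a)

theorem pathProb_nonneg (σ : ∀ s, stdSimplex ℝ (Act s)) (l : List (Σ s, Act s)) :
    0 ≤ pathProb σ l := by
  refine List.prod_nonneg fun x hx => ?_
  obtain ⟨y, -, rfl⟩ := List.mem_map.1 hx
  exact (σ y.1).2.1 y.2

theorem pathProb_le_one (σ : ∀ s, stdSimplex ℝ (Act s)) (l : List (Σ s, Act s)) :
    pathProb σ l ≤ 1 := by
  induction l with
  | nil => simp
  | cons x l ih =>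
    have : pathProb σ (x :: l) = (σ x.1).1 x.2 * pathProb σ l := by simp [pathProb]
    rw [this]
    exact mul_le_one₀ (apply_le_one σ _ _) (pathProb_nonneg σ l) ih

theorem infosets_chance (n : ℕ) (p : stdSimplex ℝ (Fin n)) (next : Fin n → GameTree Info Act)
    (s : Info) : s ∈ (chance n p next).infosets ↔ ∃ c, s ∈ (next c).infosets := by
  simp [infosets]

theorem infosets_decision (s' : Info) (next : Act s' → GameTree Info Act)
    (s : Info) : s ∈ (decision s' next).infosets ↔ s = s' ∨ ∃ a, s ∈ (next a).infosets := by
  simp [infosets]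

theorem nodeCount_nonneg (s : Info) (t : GameTree Info Act) : 0 ≤ t.nodeCount s := by
  induction t with
  | leaf u => simp [nodeCount]
  | chance n p next ih => exact Finset.sum_nonneg fun c _ => ih c
  | decision s' next ih =>
    exact add_nonneg (by split_ifs <;> norm_num) (Finset.sum_nonneg fun a _ => ih a)

theorem nodeCount_pos {s : Info} {t : GameTree Info Act} (h : s ∈ t.infosets) :
    0 < t.nodeCount s := by
  induction t with
  | leaf u => simp [infosets] at h
  | chance n p next ih =>
    obtain ⟨c, hc⟩ := (infosets_chance n p next s).1 h
    exact Finset.sum_pos' (fun c _ => nodeCount_nonneg s _) ⟨c, Finset.mem_univ c, ih c hc⟩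
  | decision s' next ih =>
    rcases (infosets_decision s' next s).1 h with rfl | ⟨a, ha⟩
    · exact add_pos_of_pos_of_nonneg (by simp)
        (Finset.sum_nonneg fun a _ => nodeCount_nonneg _ _)
    · exact add_pos_of_nonneg_of_pos (by split_ifs <;> norm_num)
        (Finset.sum_pos' (fun c _ => nodeCount_nonneg s _) ⟨a, Finset.mem_univ a, ih a ha⟩)

/-- With perfect recall, what a player has done so far is the beginning of what the player has
done when reaching any information set further down. -/
theorem RecallFrom.prefix {player : Info → Fin 2} {own : Info → List (Σ s, Act s)}
    {past : Fin 2 → List (Σ s, Act s)} {t : GameTree Info Act} {s : Info}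
    (h : t.RecallFrom player own past) (hs : s ∈ t.infosets) : past (player s) <+: own s := by
  induction t generalizing past with
  | leaf u => simp [infosets] at hs
  | chance n p next ih =>
    obtain ⟨c, hc⟩ := (infosets_chance n p next s).1 hs
    exact ih c (h c) hc
  | decision s' next ih =>
    rcases (infosets_decision s' next s).1 hs with rfl | ⟨a, ha⟩
    · exact h.1 ▸ List.prefix_refl _
    · have := ih a (h.2 a) ha
      by_cases hp : player s = player s'
      · rw [hp, Function.update_self] at this
        rw [hp]
        exact (List.prefix_append _ _).trans this
      · rwa [Function.update_of_ne hp] at this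

/-- With perfect recall all nodes of an information set have the same own reaching probability, so
that their sum is a multiple of it. -/
theorem RecallFrom.pathProb_mul_ownReach {player : Info → Fin 2}
    {own : Info → List (Σ s, Act s)} {past : Fin 2 → List (Σ s, Act s)} {t : GameTree Info Act}
    (h : t.RecallFrom player own past) (σ : ∀ s, stdSimplex ℝ (Act s)) (s : Info) :
    pathProb σ (past (player s)) * t.ownReach player σ (player s) s =
      t.nodeCount s * pathProb σ (own s) := by
  induction t generalizing past with
  | leaf u => simp [ownReach, nodeCount]
  | chance n p next ih =>
    simp only [ownReach, nodeCount, Finset.mul_sum, Finset.sum_mul]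
    exact Finset.sum_congr rfl fun c _ => ih c (h c)
  | decision s' next ih =>
    simp only [ownReach, nodeCount, mul_add, add_mul, Finset.mul_sum, Finset.sum_mul]
    congr 1
    · split_ifs with hs
      · subst hs
        rw [h.1]
        ring
      · simp
    · refine Finset.sum_congr rfl fun a _ => ?_
      rw [← ih a (h.2 a)]
      by_cases hp : player s' = player s
      · rw [if_pos hp, ← hp, Function.update_self, pathProb_append_singleton, mul_assoc]
      · rw [if_neg hp, Function.update_of_ne (Ne.symm hp), one_mul]

theorem value_one (σ : ∀ s, stdSimplex ℝ (Act s)) (t : GameTree Info Act) :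
    t.value σ 1 = -t.value σ 0 := by
  induction t with
  | leaf u => simp [value]
  | chance n p next ih => simp [value, ih]
  | decision s next ih => simp [value, ih]

theorem value_le {i : Fin 2} {b : ℝ} (σ : ∀ s, stdSimplex ℝ (Act s)) {t : GameTree Info Act}
    (h : ∀ u ∈ t.payoffs, (if i = 0 then u else -u) ≤ b) : t.value σ i ≤ b := by
  induction t with
  | leaf u => exact h u rfl
  | chance n p next ih =>
    calc ∑ c, p.1 c * (next c).value σ i ≤ ∑ c, p.1 c * b := Finset.sum_le_sum fun c _ =>
          mul_le_mul_of_nonneg_left (ih c fun u hu => h u (Set.mem_iUnion.2 ⟨c, hu⟩)) (p.2.1 c)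
      _ = b := by rw [← Finset.sum_mul, p.2.2, one_mul]
  | decision s next ih =>
    calc ∑ a, (σ s).1 a * (next a).value σ i ≤ ∑ a, (σ s).1 a * b := Finset.sum_le_sum fun c _ =>
          mul_le_mul_of_nonneg_left (ih c fun u hu => h u (Set.mem_iUnion.2 ⟨c, hu⟩))
            ((σ s).2.1 c)
      _ = b := by rw [← Finset.sum_mul, (σ s).2.2, one_mul]

theorem le_value {i : Fin 2} {b : ℝ} (σ : ∀ s, stdSimplex ℝ (Act s)) {t : GameTree Info Act}
    (h : ∀ u ∈ t.payoffs, b ≤ if i = 0 then u else -u) : b ≤ t.value σ i := by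
  induction t with
  | leaf u => exact h u rfl
  | chance n p next ih =>
    calc b = ∑ c, p.1 c * b := by rw [← Finset.sum_mul, p.2.2, one_mul]
      _ ≤ ∑ c, p.1 c * (next c).value σ i := Finset.sum_le_sum fun c _ =>
          mul_le_mul_of_nonneg_left (ih c fun u hu => h u (Set.mem_iUnion.2 ⟨c, hu⟩)) (p.2.1 c)
  | decision s next ih =>
    calc b = ∑ a, (σ s).1 a * b := by rw [← Finset.sum_mul, (σ s).2.2, one_mul]
      _ ≤ ∑ a, (σ s).1 a * (next a).value σ i := Finset.sum_le_sum fun c _ =>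
          mul_le_mul_of_nonneg_left (ih c fun u hu => h u (Set.mem_iUnion.2 ⟨c, hu⟩))
            ((σ s).2.1 c)

theorem value_sub_value_le {Δ : ℝ} (σ τ : ∀ s, stdSimplex ℝ (Act s)) (i : Fin 2)
    {t t' : GameTree Info Act} (h : ∀ u ∈ t.payoffs, ∀ u' ∈ t'.payoffs, |u - u'| ≤ Δ) :
    t.value σ i - t'.value τ i ≤ Δ := by
  rw [sub_le_iff_le_add]
  refine value_le σ fun u hu => ?_
  rw [← sub_le_iff_le_add']
  refine le_value τ fun u' hu' => ?_
  have := abs_le.1 (h u hu u' hu')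
  split_ifs <;> linarith

/-- If, for every information set of player `j`, `τ` mixes the strategies `σ 0, …, σ (T - 1)` with
weights proportional to the own reaching probabilities, then by perfect recall the payoff of `τ`
against any opponent is the average of the payoffs of `σ 0, …, σ (T - 1)`. -/
theorem RecallFrom.sum_pathProb_mul_value {player : Info → Fin 2}
    {own : Info → List (Σ s, Act s)} {past : Fin 2 → List (Σ s, Act s)} {t : GameTree Info Act}
    (h : t.RecallFrom player own past) (j : Fin 2) (σ : ℕ → ∀ s, stdSimplex ℝ (Act s))
    (τ π : ∀ s, stdSimplex ℝ (Act s)) (T : ℕ)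
    (hτ : ∀ s ∈ t.infosets, player s = j → ∀ a,
      ∑ n ∈ Finset.range T, pathProb (σ n) (own s) * (σ n s).1 a =
        (∑ n ∈ Finset.range T, pathProb (σ n) (own s)) * (τ s).1 a) (i : Fin 2) :
    ∑ n ∈ Finset.range T, pathProb (σ n) (past j) *
        t.value (fun s => if player s = j then σ n s else π s) i =
      (∑ n ∈ Finset.range T, pathProb (σ n) (past j)) *
        t.value (fun s => if player s = j then τ s else π s) i := by
  induction t generalizing past with
  | leaf u => simp only [value, Finset.sum_mul]
  | chance n p next ih =>
    simp only [value, Finset.mul_sum]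
    rw [Finset.sum_comm]
    refine Finset.sum_congr rfl fun c _ => ?_
    rw [mul_left_comm, ← ih c (h c) fun s hs => hτ s ((infosets_chance n p next s).2 ⟨c, hs⟩),
      Finset.mul_sum]
    exact Finset.sum_congr rfl fun _ _ => mul_left_comm _ _ _
  | decision s next ih =>
    simp only [value, Finset.mul_sum]
    rw [Finset.sum_comm]
    refine Finset.sum_congr rfl fun a _ => ?_
    have ih' := ih a (h.2 a) fun s' hs =>
      hτ s' ((infosets_decision s next s').2 (Or.inr ⟨a, hs⟩))
    by_cases hp : player s = j
    · have hs := hτ s ((infosets_decision s next s).2 (Or.inl rfl)) hp a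
      have hown := h.1
      subst hp
      simp only [Function.update_self, pathProb_append_singleton] at ih'
      rw [← hown] at ih' ⊢
      rw [hs] at ih'
      simp only [if_true]
      rw [← mul_assoc, ← ih']
      exact Finset.sum_congr rfl fun _ _ => (mul_assoc _ _ _).symm
    · rw [Function.update_of_ne (Ne.symm hp)] at ih'
      simp only [if_neg hp]
      rw [mul_left_comm, ← ih', Finset.mul_sum]
      exact Finset.sum_congr rfl fun _ _ => mul_left_comm _ _ _

/-! ### Counterfactual regrets -/

theorem cfRegret_eq_zero (player : Info → Fin 2) (σ : ∀ s, stdSimplex ℝ (Act s)) (i : Fin 2)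
    {t : GameTree Info Act} {s : Info} (hs : s ∉ t.infosets) (a : Act s) :
    t.cfRegret player σ i s a = 0 := by
  classical
  induction t with
  | leaf u => simp [cfRegret]
  | chance n p next ih =>
    simp only [infosets_chance, not_exists] at hs
    simp only [cfRegret, Finset.sum_apply, Pi.smul_apply, smul_eq_mul]
    exact Finset.sum_eq_zero fun c _ => by rw [ih c (hs c), mul_zero]
  | decision s' next ih =>
    simp only [infosets_decision, not_or, not_exists] at hs
    simp only [cfRegret]
    split_ifs
    · simp only [Pi.add_apply, Pi.single_eq_of_ne hs.1, Finset.sum_apply, Pi.zero_apply, zero_add]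
      exact Finset.sum_eq_zero fun c _ => ih c (hs.2 c)
    · simp only [Finset.sum_apply, Pi.smul_apply, smul_eq_mul]
      exact Finset.sum_eq_zero fun c _ => by rw [ih c (hs.2 c), mul_zero]

theorem sum_mul_value_sub_value (σ : ∀ s, stdSimplex ℝ (Act s)) (i : Fin 2) (s : Info)
    (next : Act s → GameTree Info Act) :
    ∑ a, (σ s).1 a * ((next a).value σ i - (decision s next).value σ i) = 0 := by
  simp only [mul_sub, Finset.sum_sub_distrib, ← Finset.sum_mul, (σ s).2.2, one_mul]
  simp [value]

/-- The current strategy has no counterfactual regret on average over its actions. -/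
theorem sum_mul_cfRegret (player : Info → Fin 2) (σ : ∀ s, stdSimplex ℝ (Act s)) (i : Fin 2)
    (t : GameTree Info Act) (s : Info) : ∑ a, (σ s).1 a * t.cfRegret player σ i s a = 0 := by
  classical
  induction t with
  | leaf u => simp [cfRegret]
  | chance n p next ih =>
    simp only [cfRegret, Finset.sum_apply, Pi.smul_apply, smul_eq_mul, Finset.mul_sum]
    rw [Finset.sum_comm]
    refine Finset.sum_eq_zero fun c _ => ?_
    simp only [mul_left_comm _ (p.1 c)]
    rw [← Finset.mul_sum, ih c, mul_zero]
  | decision s' next ih =>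
    simp only [cfRegret]
    split_ifs
    · simp only [Pi.add_apply, Finset.sum_apply, mul_add, Finset.sum_add_distrib, Finset.mul_sum]
      rw [Finset.sum_comm, Finset.sum_eq_zero (s := Finset.univ (α := Act s')) fun c _ => ih c,
        add_zero]
      rcases eq_or_ne s s' with rfl | hs
      · simp only [Pi.single_eq_same]
        exact sum_mul_value_sub_value σ i s next
      · simp [Pi.single_eq_of_ne hs]
    · simp only [Finset.sum_apply, Pi.smul_apply, smul_eq_mul, Finset.mul_sum]
      rw [Finset.sum_comm]
      refine Finset.sum_eq_zero fun c _ => ?_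
      simp only [mul_left_comm _ ((σ s').1 c)]
      rw [← Finset.mul_sum, ih c, mul_zero]

/-- With perfect recall, counterfactual regrets are bounded by the payoff range: below a decision
node of the player, only one of the branches can lead to the information set `s`, and none if the
node itself belongs to `s`. -/
theorem RecallFrom.abs_cfRegret_le {player : Info → Fin 2} {own : Info → List (Σ s, Act s)}
    {past : Fin 2 → List (Σ s, Act s)} {t : GameTree Info Act}
    (h : t.RecallFrom player own past) {Δ : ℝ} (hΔ : 0 ≤ Δ)
    (hpay : ∀ u ∈ t.payoffs, ∀ u' ∈ t.payoffs, |u - u'| ≤ Δ)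
    (σ : ∀ s, stdSimplex ℝ (Act s)) (s : Info) (a : Act s) :
    |t.cfRegret player σ (player s) s a| ≤ Δ := by
  classical
  induction t generalizing past with
  | leaf u => simpa [cfRegret] using hΔ
  | chance n p next ih =>
    simp only [cfRegret, Finset.sum_apply, Pi.smul_apply, smul_eq_mul]
    calc _ ≤ ∑ c, |p.1 c * (next c).cfRegret player σ (player s) s a| :=
          Finset.abs_sum_le_sum_abs _ _
      _ ≤ ∑ c, p.1 c * Δ := Finset.sum_le_sum fun c _ => by
          rw [abs_mul, abs_of_nonneg (p.2.1 c)]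
          exact mul_le_mul_of_nonneg_left (ih c (h c) fun u hu u' hu' =>
            hpay u (Set.mem_iUnion.2 ⟨c, hu⟩) u' (Set.mem_iUnion.2 ⟨c, hu'⟩)) (p.2.1 c)
      _ = Δ := by rw [← Finset.sum_mul, p.2.2, one_mul]
  | decision s' next ih =>
    have ih' : ∀ b, |(next b).cfRegret player σ (player s) s a| ≤ Δ := fun b =>
      ih b (h.2 b) fun u hu u' hu' =>
        hpay u (Set.mem_iUnion.2 ⟨b, hu⟩) u' (Set.mem_iUnion.2 ⟨b, hu'⟩)
    simp only [cfRegret]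
    split_ifs with hp
    · have hpre : ∀ b, s ∈ (next b).infosets → past (player s') ++ [⟨s', b⟩] <+: own s := by
        intro b hb
        have := (h.2 b).prefix hb
        rwa [← hp, Function.update_self] at this
      simp only [Pi.add_apply, Finset.sum_apply]
      rcases eq_or_ne s s' with rfl | hs
      · have hno : ∀ b, s ∉ (next b).infosets := by
          intro b hb
          have := (hpre b hb).length_le
          simp [h.1] at this
        rw [Finset.sum_eq_zero fun b _ => cfRegret_eq_zero player σ _ (hno b) a, add_zero,
          Pi.single_eq_same, abs_le']
        have hsub : ∀ u ∈ (next a).payoffs, u ∈ (decision s next).payoffs := fun u hu =>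
          Set.mem_iUnion.2 ⟨a, hu⟩
        refine ⟨value_sub_value_le σ σ _ fun u hu u' hu' => hpay u (hsub u hu) u' hu', ?_⟩
        rw [neg_sub]
        exact value_sub_value_le σ σ _ fun u hu u' hu' => hpay u hu u' (hsub u' hu')
      · rw [Pi.single_eq_of_ne hs, Pi.zero_apply, zero_add]
        by_cases hex : ∃ b, s ∈ (next b).infosets
        · obtain ⟨b, hb⟩ := hex
          rw [Finset.sum_eq_single b]
          · exact ih' b
          · intro b' _ hne
            refine cfRegret_eq_zero player σ _ (fun hb' => hne ?_) a
            have h1 := List.prefix_of_prefix_length_le (hpre b' hb') (hpre b hb) (by simp)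
            have h2 := h1.eq_of_length (by simp)
            simpa using h2
          · simp
        · push Not at hex
          rw [Finset.sum_eq_zero fun b _ => cfRegret_eq_zero player σ _ (hex b) a]
          simpa using hΔ
    · simp only [Finset.sum_apply, Pi.smul_apply, smul_eq_mul]
      calc _ ≤ ∑ c, |(σ s').1 c * (next c).cfRegret player σ (player s) s a| :=
            Finset.abs_sum_le_sum_abs _ _
        _ ≤ ∑ c, (σ s').1 c * Δ := Finset.sum_le_sum fun c _ => by
            rw [abs_mul, abs_of_nonneg ((σ s').2.1 c)]
            exact mul_le_mul_of_nonneg_left (ih' c) ((σ s').2.1 c)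
        _ = Δ := by rw [← Finset.sum_mul, (σ s').2.2, one_mul]

/-- The regret with respect to a deviation `π` of player `i` is composed of the counterfactual
regrets at the information sets of player `i`. -/
theorem RecallFrom.pathProb_mul_value_sub {player : Info → Fin 2}
    {own : Info → List (Σ s, Act s)} {past : Fin 2 → List (Σ s, Act s)} {t : GameTree Info Act}
    (h : t.RecallFrom player own past) (i : Fin 2) (σ π : ∀ s, stdSimplex ℝ (Act s))
    (S : Finset Info) (hS : ∀ s ∈ t.infosets, player s = i → s ∈ S) :
    pathProb π (past i) *
        (t.value (fun s => if player s = i then π s else σ s) i - t.value σ i) =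
      ∑ s ∈ S, pathProb π (own s) * ∑ a, (π s).1 a * t.cfRegret player σ i s a := by
  classical
  induction t generalizing past with
  | leaf u => simp [value, cfRegret]
  | chance n p next ih =>
    simp only [value, cfRegret, Finset.sum_apply, Pi.smul_apply, smul_eq_mul,
      ← Finset.sum_sub_distrib, ← mul_sub]
    have : ∀ s ∈ S, pathProb π (own s) * ∑ a, (π s).1 a *
        ∑ c, p.1 c * (next c).cfRegret player σ i s a =
        ∑ c, p.1 c * (pathProb π (own s) * ∑ a, (π s).1 a *
          (next c).cfRegret player σ i s a) := by
      intro s _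
      simp only [Finset.mul_sum]
      rw [Finset.sum_comm]
      exact Finset.sum_congr rfl fun c _ => Finset.sum_congr rfl fun a _ => by ring
    rw [Finset.sum_congr rfl this, Finset.sum_comm, Finset.mul_sum]
    refine Finset.sum_congr rfl fun c _ => ?_
    rw [← Finset.mul_sum, ← ih c (h c) fun s hs =>
      hS s ((infosets_chance n p next s).2 ⟨c, hs⟩)]
    ring
  | decision s' next ih =>
    have ih' := fun b => ih b (h.2 b) fun s hs =>
      hS s ((infosets_decision s' next s).2 (Or.inr ⟨b, hs⟩))
    by_cases hp : player s' = i
    · have hs' := hS s' ((infosets_decision s' next s').2 (Or.inl rfl)) hp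
      have hown := h.1
      rw [hp] at hown
      simp only [hp, Function.update_self, pathProb_append_singleton] at ih'
      simp only [cfRegret, if_pos hp, Pi.add_apply, Finset.sum_apply, mul_add,
        Finset.sum_add_distrib]
      have h1 : ∑ s ∈ S, pathProb π (own s) * ∑ a, (π s).1 a *
          (Pi.single s' (fun a => (next a).value σ i - (decision s' next).value σ i) :
            ∀ s, Act s → ℝ) s a =
          pathProb π (past i) * ∑ a, (π s').1 a *
            ((next a).value σ i - (decision s' next).value σ i) := by
        rw [Finset.sum_eq_single s']
        · rw [hown]
          simp
        · intro b _ hb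
          simp [Pi.single_eq_of_ne hb]
        · exact fun hn => absurd hs' hn
      have h2 : ∀ s ∈ S, pathProb π (own s) * ∑ a, (π s).1 a *
          ∑ c, (next c).cfRegret player σ i s a =
          ∑ c, pathProb π (own s) * ∑ a, (π s).1 a *
            (next c).cfRegret player σ i s a := by
        intro s _
        simp only [Finset.mul_sum]
        rw [Finset.sum_comm]
      rw [h1, Finset.sum_congr rfl h2, Finset.sum_comm, Finset.sum_congr rfl fun c _ =>
        (ih' c).symm]
      have h3 : (decision s' next).value (fun s => if player s = i then π s else σ s) i =
          ∑ a, (π s').1 a * (next a).value (fun s => if player s = i then π s else σ s) i := by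
        simp [value, hp]
      have h4 : (decision s' next).value σ i =
          ∑ a, (π s').1 a * (decision s' next).value σ i := by
        rw [← Finset.sum_mul, (π s').2.2, one_mul]
      conv_lhs => rw [h3, h4]
      rw [← Finset.sum_sub_distrib, Finset.mul_sum, Finset.mul_sum, ← Finset.sum_add_distrib]
      exact Finset.sum_congr rfl fun a _ => by ring
    · simp only [Function.update_of_ne (Ne.symm hp)] at ih'
      simp only [value, cfRegret, if_neg hp, Finset.sum_apply, Pi.smul_apply, smul_eq_mul,
        ← Finset.sum_sub_distrib, ← mul_sub]
      have : ∀ s ∈ S, pathProb π (own s) * ∑ a, (π s).1 a *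
          ∑ c, (σ s').1 c * (next c).cfRegret player σ i s a =
          ∑ c, (σ s').1 c * (pathProb π (own s) * ∑ a, (π s).1 a *
            (next c).cfRegret player σ i s a) := by
        intro s _
        simp only [Finset.mul_sum]
        rw [Finset.sum_comm]
        exact Finset.sum_congr rfl fun c _ => Finset.sum_congr rfl fun a _ => by ring
      rw [Finset.sum_congr rfl this, Finset.sum_comm, Finset.mul_sum]
      refine Finset.sum_congr rfl fun c _ => ?_
      rw [← Finset.mul_sum, ← ih' c]
      ring

end Values

end GameTree

theorem GameTree.payoffs_nonempty {Info : Type u} {Act : Info → Type u} [∀ s, Nonempty (Act s)]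
    (t : GameTree Info Act) : t.payoffs.Nonempty := by
  induction t with
  | leaf u => exact ⟨u, rfl⟩
  | chance n p next ih =>
    have : Nonempty (Fin n) := by
      by_contra hn
      rw [not_nonempty_iff] at hn
      have := p.2.2
      simp at this
    obtain ⟨c⟩ := this
    obtain ⟨u, hu⟩ := ih c
    exact ⟨u, Set.mem_iUnion.2 ⟨c, hu⟩⟩
  | decision s next ih =>
    obtain ⟨a⟩ := (inferInstance : Nonempty (Act s))
    obtain ⟨u, hu⟩ := ih a
    exact ⟨u, Set.mem_iUnion.2 ⟨a, hu⟩⟩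

namespace EFGame

variable {G : EFGame.{u}}

theorem PayoffRangeLE.nonneg {Δ : ℝ} (h : G.PayoffRangeLE Δ) : 0 ≤ Δ := by
  obtain ⟨u, hu⟩ := G.root.payoffs_nonempty
  simpa using h u hu u hu

theorem PayoffRangeLE.abs_le {Δ : ℝ} (h : G.PayoffRangeLE Δ) :
    ∀ u ∈ G.root.payoffs, ∀ u' ∈ G.root.payoffs, |u - u'| ≤ Δ := fun u hu u' hu' =>
  abs_le'.2 ⟨h u hu u' hu', by rw [neg_sub]; exact h u' hu' u hu⟩

theorem max_zero_eq_sum_mul_regretMatching (Q : ∀ s, G.Act s → ℝ) (s : G.Info) (a : G.Act s) :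
    max 0 (Q s a) = (∑ b, max 0 (Q s b)) * (regretMatching Q s).1 a := by
  unfold regretMatching
  split_ifs with h
  · exact (mul_div_cancel₀ _ h.ne').symm
  · have h0 : ∑ b, max 0 (Q s b) = 0 :=
      le_antisymm (not_lt.1 h) (Finset.sum_nonneg fun _ _ => le_max_left _ _)
    rw [h0, zero_mul]
    exact (Finset.sum_eq_zero_iff_of_nonneg fun _ _ => le_max_left _ _).1 h0 a (Finset.mem_univ a)

theorem sq_max_zero_add_le (q r : ℝ) :
    max 0 (q + r) ^ 2 ≤ max 0 q ^ 2 + 2 * (max 0 q * r) + r ^ 2 := by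
  have h : max 0 (q + r) ≤ |max 0 q + r| :=
    max_le (abs_nonneg _) ((add_le_add_left (le_max_right 0 q) r).trans (le_abs_self _))
  calc max 0 (q + r) ^ 2 ≤ |max 0 q + r| ^ 2 := pow_le_pow_left₀ (le_max_left _ _) h 2
    _ = _ := by rw [sq_abs]; ring

/-- Blackwell's argument for regret matching: the positive parts of the cumulative counterfactual
regrets are orthogonal to the next instantaneous regrets, so that their square sum grows at most
linearly. -/
theorem sum_sq_max_zero_cfrRegrets_le (hG : G.PerfectRecall) {Δ : ℝ} (hΔ : G.PayoffRangeLE Δ)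
    (n : ℕ) (s : G.Info) :
    ∑ a, max 0 (G.cfrRegrets n s a) ^ 2 ≤ n * (Fintype.card (G.Act s) * Δ ^ 2) := by
  obtain ⟨own, hown⟩ := hG
  induction n with
  | zero => simp [cfrRegrets]
  | succ n ih =>
    set σ := regretMatching (G.cfrRegrets n)
    set r := G.root.cfRegret G.player σ (G.player s) s
    have horth : ∑ a, max 0 (G.cfrRegrets n s a) * r a = 0 := by
      rw [Finset.sum_congr rfl fun a _ => by
          rw [max_zero_eq_sum_mul_regretMatching (G.cfrRegrets n) s a, mul_assoc],
        ← Finset.mul_sum, G.root.sum_mul_cfRegret G.player σ, mul_zero]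
    have hr : ∑ a, r a ^ 2 ≤ Fintype.card (G.Act s) * Δ ^ 2 := by
      rw [← nsmul_eq_mul]
      refine Finset.sum_le_card_nsmul _ _ _ fun a _ => ?_
      rw [← sq_abs]
      exact pow_le_pow_left₀ (abs_nonneg _)
        (hown.abs_cfRegret_le hΔ.nonneg hΔ.abs_le σ s a) 2
    calc ∑ a, max 0 (G.cfrRegrets n s a + r a) ^ 2
        ≤ ∑ a, (max 0 (G.cfrRegrets n s a) ^ 2 + 2 * (max 0 (G.cfrRegrets n s a) * r a) +
            r a ^ 2) := Finset.sum_le_sum fun a _ => sq_max_zero_add_le _ _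
      _ = ∑ a, max 0 (G.cfrRegrets n s a) ^ 2 + ∑ a, r a ^ 2 := by
          rw [Finset.sum_add_distrib, Finset.sum_add_distrib, ← Finset.mul_sum, horth, mul_zero,
            add_zero]
      _ ≤ n * (Fintype.card (G.Act s) * Δ ^ 2) + Fintype.card (G.Act s) * Δ ^ 2 :=
          add_le_add ih hr
      _ = _ := by push_cast; ring

theorem cfrRegrets_eq_sum (n : ℕ) (s : G.Info) (a : G.Act s) :
    G.cfrRegrets n s a =
      ∑ t ∈ Finset.range n, G.root.cfRegret G.player (cfr G t) (G.player s) s a := by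
  induction n with
  | zero => simp [cfrRegrets]
  | succ n ih =>
    rw [Finset.sum_range_succ, ← ih]
    rfl

theorem card_act_le_maxActions {s : G.Info} (hs : s ∈ G.root.infosets) :
    Fintype.card (G.Act s) ≤ G.maxActions :=
  Finset.le_sup (f := fun s => Fintype.card (G.Act s)) hs

theorem regretAgainst_cfr_le (hG : G.PerfectRecall) {Δ : ℝ} (hΔ : G.PayoffRangeLE Δ) (i : Fin 2)
    (T : ℕ) (π : G.Profile) :
    regretAgainst (cfr G) i T π ≤ Δ * G.numInfosets i * √((G.maxActions : ℝ) * T) := by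
  classical
  obtain ⟨own, hown⟩ := id hG
  set S := G.root.infosets.filter fun s => G.player s = i with hS
  have hdec : regretAgainst (cfr G) i T π =
      ∑ s ∈ S, GameTree.pathProb π (own s) * ∑ a, (π s).1 a * G.cfrRegrets T s a := by
    calc regretAgainst (cfr G) i T π
        = ∑ t ∈ Finset.range T, ∑ s ∈ S, GameTree.pathProb π (own s) *
            ∑ a, (π s).1 a * G.root.cfRegret G.player (cfr G t) i s a := by
          refine Finset.sum_congr rfl fun t _ => ?_
          rw [← hown.pathProb_mul_value_sub i (cfr G t) π S fun s h1 h2 =>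
            Finset.mem_filter.2 ⟨h1, h2⟩, GameTree.pathProb_nil, one_mul]
          rfl
      _ = _ := by
          rw [Finset.sum_comm]
          refine Finset.sum_congr rfl fun s hs => ?_
          rw [← Finset.mul_sum, Finset.sum_comm]
          congr 1
          refine Finset.sum_congr rfl fun a _ => ?_
          rw [cfrRegrets_eq_sum, (Finset.mem_filter.1 hs).2, Finset.mul_sum]
  have hle : ∀ s ∈ S, GameTree.pathProb π (own s) * ∑ a, (π s).1 a * G.cfrRegrets T s a ≤
      Δ * √((G.maxActions : ℝ) * T) := by
    intro s hs
    have hcard : (Fintype.card (G.Act s) : ℝ) ≤ G.maxActions := by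
      exact_mod_cast card_act_le_maxActions (Finset.mem_filter.1 hs).1
    have hQ : ∀ a, max 0 (G.cfrRegrets T s a) ≤ Δ * √((G.maxActions : ℝ) * T) := by
      intro a
      rw [← abs_of_nonneg (le_max_left 0 (G.cfrRegrets T s a))]
      refine abs_le_of_sq_le_sq ?_ (mul_nonneg hΔ.nonneg (Real.sqrt_nonneg _))
      rw [mul_pow, Real.sq_sqrt (by positivity)]
      calc max 0 (G.cfrRegrets T s a) ^ 2
          ≤ ∑ a, max 0 (G.cfrRegrets T s a) ^ 2 :=
            Finset.single_le_sum (f := fun a => max 0 (G.cfrRegrets T s a) ^ 2)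
              (fun b _ => sq_nonneg _) (Finset.mem_univ a)
        _ ≤ T * (Fintype.card (G.Act s) * Δ ^ 2) := sum_sq_max_zero_cfrRegrets_le hG hΔ T s
        _ ≤ T * (G.maxActions * Δ ^ 2) := by gcongr
        _ = _ := by ring
    calc GameTree.pathProb π (own s) * ∑ a, (π s).1 a * G.cfrRegrets T s a
        ≤ GameTree.pathProb π (own s) * ∑ a, (π s).1 a * (Δ * √((G.maxActions : ℝ) * T)) := by
          refine mul_le_mul_of_nonneg_left (Finset.sum_le_sum fun a _ => ?_)
            (GameTree.pathProb_nonneg _ _)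
          exact mul_le_mul_of_nonneg_left ((le_max_right _ _).trans (hQ a)) ((π s).2.1 a)
      _ = GameTree.pathProb π (own s) * (Δ * √((G.maxActions : ℝ) * T)) := by
          rw [← Finset.sum_mul, (π s).2.2, one_mul]
      _ ≤ _ := mul_le_of_le_one_left (mul_nonneg hΔ.nonneg (Real.sqrt_nonneg _))
          (GameTree.pathProb_le_one _ _)
  rw [hdec]
  refine (Finset.sum_le_card_nsmul _ _ _ hle).trans (le_of_eq ?_)
  rw [nsmul_eq_mul, numInfosets, hS]
  ring

/-! ### Average strategies and Nash equilibria -/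

theorem value_eq_neg {i j : Fin 2} (hij : i ≠ j) (σ : G.Profile) : value i σ = -value j σ := by
  have h : value 1 σ = -value 0 σ := G.root.value_one σ
  fin_cases i <;> fin_cases j <;> simp_all

theorem deviate_swap {i j : Fin 2} (hij : i ≠ j) (π σ : G.Profile) :
    deviate i π σ = deviate j σ π := by
  funext s
  by_cases h : G.player s = j
  · have h' : G.player s ≠ i := by omega
    simp only [deviate, if_pos h, if_neg h']
  · have h' : G.player s = i := by omega
    simp only [deviate, if_neg h, if_pos h']

@[simp]
theorem deviate_self (i : Fin 2) (σ : G.Profile) : deviate i σ σ = σ := by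
  funext s
  simp [deviate]

theorem average_apply {σ : ℕ → G.Profile} {T : ℕ} {s : G.Info}
    (h : 0 < ∑ t ∈ Finset.range T, reachWeight (σ t) s) (a : G.Act s) :
    (average σ T s).1 a = (∑ t ∈ Finset.range T, reachWeight (σ t) s * (σ t s).1 a) /
      ∑ t ∈ Finset.range T, reachWeight (σ t) s := by
  unfold average
  rw [dif_pos h]

/-- The defining property of the average strategy, in terms of the reaching probabilities along
the unique own path to an information set. -/
theorem sum_pathProb_mul_apply {own : G.Info → List (Σ s, G.Act s)}
    (hown : G.root.RecallFrom G.player own fun _ => []) (σ : ℕ → G.Profile) (T : ℕ) {s : G.Info}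
    (hs : s ∈ G.root.infosets) (a : G.Act s) :
    ∑ n ∈ Finset.range T, GameTree.pathProb (σ n) (own s) * (σ n s).1 a =
      (∑ n ∈ Finset.range T, GameTree.pathProb (σ n) (own s)) * (average σ T s).1 a := by
  have hpos := GameTree.nodeCount_pos hs
  have hw : ∀ n, reachWeight (σ n) s =
      G.root.nodeCount s * GameTree.pathProb (σ n) (own s) := fun n => by
    rw [← hown.pathProb_mul_ownReach, GameTree.pathProb_nil, one_mul]
    rfl
  by_cases h : 0 < ∑ n ∈ Finset.range T, GameTree.pathProb (σ n) (own s)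
  · rw [average_apply (by simpa only [hw, ← Finset.mul_sum] using mul_pos hpos h)]
    simp only [hw, mul_assoc, ← Finset.mul_sum]
    rw [mul_div_mul_left _ _ hpos.ne', mul_div_cancel₀ _ h.ne']
  · have h0 : ∑ n ∈ Finset.range T, GameTree.pathProb (σ n) (own s) = 0 :=
      le_antisymm (not_lt.1 h)
        (Finset.sum_nonneg fun _ _ => GameTree.pathProb_nonneg _ _)
    rw [h0, zero_mul]
    refine Finset.sum_eq_zero fun n hn => ?_
    rw [(Finset.sum_eq_zero_iff_of_nonneg fun _ _ => GameTree.pathProb_nonneg _ _).1 h0 n hn,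
      zero_mul]

/-- The payoff of the average strategy of player `j` against a fixed opponent is the average of the
payoffs. -/
theorem sum_value_deviate (hG : G.PerfectRecall) (σ : ℕ → G.Profile) (T : ℕ) (i j : Fin 2)
    (π : G.Profile) :
    ∑ n ∈ Finset.range T, value i (deviate j (σ n) π) =
      T * value i (deviate j (average σ T) π) := by
  obtain ⟨own, hown⟩ := hG
  have h := hown.sum_pathProb_mul_value j σ (average σ T) π T
    (fun s hs _ a => sum_pathProb_mul_apply hown σ T hs a) i
  simp only [GameTree.pathProb_nil, one_mul, Finset.sum_const, Finset.card_range,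
    nsmul_eq_mul, mul_one] at h
  exact h

/-- In a zero-sum game with perfect recall the average strategy is an equilibrium up to the sum of
the average regrets of both players. -/
theorem isEpsNash_average (hG : G.PerfectRecall) (σ : ℕ → G.Profile) {T : ℕ} (hT : 0 < T)
    {B : Fin 2 → ℝ} {ε : ℝ} (hreg : ∀ i π, regretAgainst σ i T π ≤ B i)
    (hB : B 0 + B 1 ≤ T * ε) : IsEpsNash ε (average σ T) := by
  intro i π
  obtain ⟨j, hij⟩ : ∃ j : Fin 2, i ≠ j := ⟨1 - i, by omega⟩
  have hB' : B i + B j ≤ T * ε := by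
    obtain ⟨rfl, rfl⟩ | ⟨rfl, rfl⟩ : i = 0 ∧ j = 1 ∨ i = 1 ∧ j = 0 := by omega
    · exact hB
    · rwa [add_comm]
  have h1 := sum_value_deviate hG σ T i j π
  have h2 := sum_value_deviate hG σ T j i (average σ T)
  rw [deviate_self] at h2
  simp only [deviate_swap hij.symm _ π] at h1
  simp only [deviate_swap hij _ (average σ T)] at h2
  have h3 := hreg i π
  have h4 := hreg j (average σ T)
  simp only [regretAgainst, Finset.sum_sub_distrib, h1, h2] at h3 h4
  have h5 : ∑ n ∈ Finset.range T, value i (σ n) = -∑ n ∈ Finset.range T, value j (σ n) := by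
    rw [← Finset.sum_neg_distrib]
    exact Finset.sum_congr rfl fun n _ => value_eq_neg hij (σ n)
  have hT' : (0 : ℝ) < T := by exact_mod_cast hT
  rw [value_eq_neg hij (average σ T)]
  refine le_of_mul_le_mul_left ?_ hT'
  linarith [mul_add (T : ℝ) (-value j (average σ T)) ε]

end EFGame

/-! ### Restricted games -/

namespace GameTree

variable {Info : Type u} {Act : Info → Type u}

theorem payoffs_restrict_subset (R : ∀ s, Finset (Act s)) (t : GameTree Info Act) :
    (t.restrict R).payoffs ⊆ t.payoffs := by
  induction t with
  | leaf u => exact subset_rfl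
  | chance n p next ih => exact Set.iUnion_mono ih
  | decision s next ih =>
    exact Set.iUnion_subset fun a => (ih a.1).trans (Set.subset_iUnion (fun a => (next a).payoffs) a.1)

open Classical in
/-- The actions of a sequence that remain available after a restriction. -/
noncomputable def restrictPath (R : ∀ s, Finset (Act s)) (l : List (Σ s, Act s)) :
    List (Σ s, {a : Act s // a ∈ R s}) :=
  l.filterMap fun x => if h : x.2 ∈ R x.1 then some ⟨x.1, x.2, h⟩ else none

theorem RecallFrom.restrict {player : Info → Fin 2} {own : Info → List (Σ s, Act s)}
    {past : Fin 2 → List (Σ s, Act s)} {t : GameTree Info Act}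
    (h : t.RecallFrom player own past) (R : ∀ s, Finset (Act s)) :
    (t.restrict R).RecallFrom player (fun s => restrictPath R (own s))
      (fun i => restrictPath R (past i)) := by
  induction t generalizing past with
  | leaf u => trivial
  | chance n p next ih => exact fun c => ih c (h c)
  | decision s next ih =>
    refine ⟨congrArg (restrictPath R) h.1, fun a => ?_⟩
    convert ih a.1 (h.2 a.1) using 1
    funext i
    by_cases hi : i = player s
    · subst hi
      simp [restrictPath, a.2]
    · simp [Function.update_of_ne hi]

theorem infosets_restrict_mono {R R' : ∀ s, Finset (Act s)} (h : ∀ s, R s ⊆ R' s)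
    [∀ s, Fintype {a : Act s // a ∈ R s}] [∀ s, Fintype {a : Act s // a ∈ R' s}]
    (t : GameTree Info Act) : (t.restrict R).infosets ⊆ (t.restrict R').infosets := by
  induction t with
  | leaf u => exact subset_rfl
  | chance n p next ih =>
    intro s hs
    obtain ⟨c, hc⟩ := (infosets_chance _ _ _ s).1 hs
    exact (infosets_chance _ _ _ s).2 ⟨c, ih c hc⟩
  | decision s' next ih =>
    intro s hs
    refine (infosets_decision _ _ s).2 ?_
    exact ((infosets_decision _ _ s).1 hs).imp_right fun ⟨a, ha⟩ =>
      ⟨⟨a.1, h s' a.2⟩, ih a.1 ha⟩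

section

variable [∀ s, Fintype (Act s)]

theorem value_restrict (R : ∀ s, Finset (Act s)) [∀ s, Fintype {a : Act s // a ∈ R s}]
    {σ : ∀ s, stdSimplex ℝ {a : Act s // a ∈ R s}} {τ : ∀ s, stdSimplex ℝ (Act s)}
    (hmem : ∀ s a (h : a ∈ R s), (τ s).1 a = (σ s).1 ⟨a, h⟩)
    (hnot : ∀ s, ∀ a ∉ R s, (τ s).1 a = 0) (i : Fin 2) (t : GameTree Info Act) :
    (t.restrict R).value σ i = t.value τ i := by
  induction t with
  | leaf u => rfl
  | chance n p next ih => exact Finset.sum_congr rfl fun c _ => by rw [← ih c]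
  | decision s next ih =>
    simp only [restrict, value, ih]
    rw [← Finset.sum_subset (Finset.subset_univ (R s))
      (fun a _ h => by rw [hnot s a h, zero_mul])]
    refine Finset.sum_bij' (fun a _ => a.1) (fun a ha => ⟨a, ha⟩) (fun a _ => a.2)
      (fun a _ => Finset.mem_univ _) (fun _ _ => rfl) (fun _ _ => rfl) fun a _ => ?_
    rw [hmem s a.1 a.2]

theorem infosets_restrict_subset (R : ∀ s, Finset (Act s)) [∀ s, Fintype {a : Act s // a ∈ R s}]
    (t : GameTree Info Act) : (t.restrict R).infosets ⊆ t.infosets := by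
  induction t with
  | leaf u => exact subset_rfl
  | chance n p next ih =>
    intro s hs
    obtain ⟨c, hc⟩ := (infosets_chance _ _ _ s).1 hs
    exact (infosets_chance _ _ _ s).2 ⟨c, ih c hc⟩
  | decision s' next ih =>
    intro s hs
    refine (infosets_decision _ _ s).2 ?_
    exact ((infosets_decision _ _ s).1 hs).imp_right fun ⟨a, ha⟩ => ⟨a.1, ih a.1 ha⟩

end

end GameTree

namespace EFGame

variable {G : EFGame.{u}}

theorem PerfectRecall.restrict (h : G.PerfectRecall) (R : G.Population) :
    (G.restrict R).PerfectRecall := by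
  obtain ⟨own, hown⟩ := h
  exact ⟨_, hown.restrict fun s => (R s).1⟩

theorem PayoffRangeLE.restrict {Δ : ℝ} (h : G.PayoffRangeLE Δ) (R : G.Population) :
    (G.restrict R).PayoffRangeLE Δ := fun u hu u' hu' =>
  h u (GameTree.payoffs_restrict_subset _ _ hu) u' (GameTree.payoffs_restrict_subset _ _ hu')

theorem expand_apply_of_mem (R : G.Population) (σ : (G.restrict R).Profile) (s : G.Info)
    (a : G.Act s) (h : a ∈ (R s).1) : (expand R σ s).1 a = (σ s).1 ⟨a, h⟩ :=
  dif_pos h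

theorem expand_apply_of_notMem (R : G.Population) (σ : (G.restrict R).Profile) (s : G.Info)
    (a : G.Act s) (h : a ∉ (R s).1) : (expand R σ s).1 a = 0 :=
  dif_neg h

theorem value_expand (R : G.Population) (σ : (G.restrict R).Profile) (i : Fin 2) :
    value i (expand R σ) = value i σ :=
  (GameTree.value_restrict (fun s => (R s).1) (expand_apply_of_mem R σ)
    (expand_apply_of_notMem R σ) i G.root).symm

theorem deviate_expand (R : G.Population) (π σ : (G.restrict R).Profile) (i : Fin 2) :
    deviate i (expand R π) (expand R σ) = expand R (deviate i π σ) := by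
  funext s
  by_cases h : G.player s = i
  · have h' : (G.restrict R).player s = i := h
    simp only [deviate, if_pos h, expand, if_pos h']
  · have h' : ¬ (G.restrict R).player s = i := h
    simp only [deviate, if_neg h, expand, if_neg h']

open Classical in
theorem toProfile_apply (b : G.PureProfile) (s : G.Info) (a : G.Act s) :
    (b.toProfile s).1 a = if a = b s then 1 else 0 := by
  simp [PureProfile.toProfile, Pi.single_apply]

theorem toProfile_eq_expand (R : G.Population) (b : G.PureProfile) (hb : ∀ s, b s ∈ (R s).1) :
    b.toProfile = expand R (PureProfile.toProfile (G := G.restrict R) fun s => ⟨b s, hb s⟩) := by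
  classical
  funext s
  refine Subtype.ext (funext fun a => ?_)
  by_cases h : a ∈ (R s).1
  · rw [expand_apply_of_mem R _ s a h]
    refine (toProfile_apply b s a).trans (Eq.trans ?_ (toProfile_apply _ _ _).symm)
    exact if_congr ⟨fun h' => Subtype.ext h', fun h' => congrArg Subtype.val h'⟩ rfl rfl
  · rw [expand_apply_of_notMem R _ s a h]
    have hne : a ≠ b s := fun h' => h (h' ▸ hb s)
    rw [toProfile_apply, if_neg hne]

theorem mem_of_add_eq {R : G.Population} {b : G.PureProfile} (h : R.add b = R) (s : G.Info) :
    b s ∈ (R s).1 := by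
  classical
  rw [← h]
  exact Finset.mem_insert_self _ _

theorem le_add (R : G.Population) (b : G.PureProfile) : R ≤ R.add b := by
  classical
  exact fun s => Finset.subset_insert _ _

/-- If the restricted game already contains best responses of the original game, then equilibria
of the restricted game are equilibria of the original game. -/
theorem IsEpsNash.expand {R : G.Population} {σ : (G.restrict R).Profile} {ε : ℝ}
    (hσ : IsEpsNash ε σ) {b : G.PureProfile} (hb : IsBestResponse (expand R σ) b)
    (hadd : R.add b = R) : IsEpsNash ε (expand R σ) := by
  intro i π
  refine (hb i π).trans ?_
  rw [toProfile_eq_expand R b (mem_of_add_eq hadd), deviate_expand, value_expand, value_expand]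
  exact hσ i _

theorem size_eq_card (G : EFGame.{u}) : G.size = G.root.infosets.card := by
  classical
  rw [size, Fin.sum_univ_two, numInfosets, numInfosets,
    ← Finset.card_filter_add_card_filter_not (s := G.root.infosets) (fun s => G.player s = 0)]
  congr 2
  exact Finset.filter_congr fun s _ => by omega

theorem size_restrict_mono {R R' : G.Population} (h : R ≤ R') :
    (G.restrict R).size ≤ (G.restrict R').size := by
  rw [size_eq_card, size_eq_card]
  exact Finset.card_le_card (GameTree.infosets_restrict_mono h G.root)

theorem size_restrict_le (R : G.Population) : (G.restrict R).size ≤ G.size := by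
  rw [size_eq_card, size_eq_card]
  exact Finset.card_le_card (GameTree.infosets_restrict_subset _ G.root)

theorem maxActions_restrict_le (R : G.Population) : (G.restrict R).maxActions ≤ G.maxActions := by
  refine Finset.sup_le fun s hs => ?_
  have h := card_act_le_maxActions (G := G) (s := s)
    (GameTree.infosets_restrict_subset _ G.root hs)
  refine le_trans ?_ h
  exact @Fintype.card_le_of_injective {a : G.Act s // a ∈ (R s).1} (G.Act s) (_) (_)
    (fun a => a.1) Subtype.val_injective

theorem maxActions_pos (h : 0 < G.size) : 0 < G.maxActions := by
  rw [size_eq_card] at h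
  obtain ⟨s, hs⟩ := Finset.card_pos.1 h
  exact Fintype.card_pos.trans_le (card_act_le_maxActions hs)

end EFGame

/-! ### Optimality of the adaptive frequency -/

theorem div_add_mul_adaptive {A s : ℕ} {ε : ℝ} (hε : 0 < ε) (hA : 0 < s → 0 < A) :
    (A : ℝ) * s ^ 3 / (ε ^ 2 * (√(A : ℝ) * s / ε)) + s * (√(A : ℝ) * s / ε) =
      2 * √(A : ℝ) * s ^ 2 / ε := by
  rcases Nat.eq_zero_or_pos s with rfl | hs
  · simp
  · have hs' : (0 : ℝ) < s := by exact_mod_cast hs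
    have hA' : (0 : ℝ) < A := by exact_mod_cast hA hs
    have hr : 0 < √(A : ℝ) := Real.sqrt_pos.2 hA'
    have hsq : (A : ℝ) = √(A : ℝ) ^ 2 := (Real.sq_sqrt hA'.le).symm
    generalize √(A : ℝ) = r at hr hsq ⊢
    rw [hsq]
    field_simp
    ring

theorem le_div_add_mul {A s : ℕ} {ε m : ℝ} (hε : 0 < ε) (hm : 0 < m) :
    2 * √(A : ℝ) * s ^ 2 / ε ≤ (A : ℝ) * s ^ 3 / (ε ^ 2 * m) + s * m := by
  have hsq : (A : ℝ) = √(A : ℝ) ^ 2 := (Real.sq_sqrt (Nat.cast_nonneg A)).symm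
  generalize √(A : ℝ) = r at hsq ⊢
  rw [hsq, ← sub_nonneg]
  have : r ^ 2 * (s : ℝ) ^ 3 / (ε ^ 2 * m) + s * m - 2 * r * s ^ 2 / ε =
      s / m * (r * s / ε - m) ^ 2 := by
    field_simp
    ring
  rw [this]
  positivity

namespace EFGame

variable {G : EFGame.{u}}

theorem rmdoBound_adaptiveFrequency {ε : ℝ} (hε : 0 < ε) (k : ℕ) (R : ℕ → G.Population) :
    rmdoBound ε k R (fun j => adaptiveFrequency ε (R j)) =
      ∑ j ∈ Finset.range k,
        (((G.restrict (R j)).maxActions : ℝ) * (G.restrict (R j)).size ^ 3 / ε ^ 2 +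
          2 * √((G.restrict (R j)).maxActions : ℝ) * (G.restrict (R j)).size ^ 2 / ε) := by
  refine Finset.sum_congr rfl fun j _ => ?_
  rw [← div_add_mul_adaptive hε (maxActions_pos (G := G.restrict (R j)))]
  simp only [adaptiveFrequency]
  ring

theorem rmdoBound_adaptiveFrequency_le {ε : ℝ} (hε : 0 < ε) (k : ℕ) (R : ℕ → G.Population)
    {m : ℕ → ℝ} (hm : ∀ j < k, 0 < m j) :
    rmdoBound ε k R (fun j => adaptiveFrequency ε (R j)) ≤ rmdoBound ε k R m := by
  rw [rmdoBound_adaptiveFrequency hε]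
  refine Finset.sum_le_sum fun j hj => ?_
  have := le_div_add_mul (A := (G.restrict (R j)).maxActions) (s := (G.restrict (R j)).size) hε
    (hm j (Finset.mem_range.1 hj))
  linarith

theorem rmdoBound_adaptiveFrequency_le_adaDOBound {ε : ℝ} (hε : 0 < ε) (k : ℕ)
    (R : ℕ → G.Population) (hR : ∀ j < k, R j ≤ R (k - 1)) :
    rmdoBound ε k R (fun j => adaptiveFrequency ε (R j)) ≤
      adaDOBound ε k G.maxActions (G.restrict (R (k - 1))).size := by
  rw [rmdoBound_adaptiveFrequency hε]
  refine (Finset.sum_le_card_nsmul _ _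
    ((G.maxActions : ℝ) * (G.restrict (R (k - 1))).size ^ 3 / ε ^ 2 +
      2 * √(G.maxActions : ℝ) * (G.restrict (R (k - 1))).size ^ 2 / ε) fun j hj => ?_).trans
    (le_of_eq ?_)
  · have hA : ((G.restrict (R j)).maxActions : ℝ) ≤ G.maxActions := by
      exact_mod_cast maxActions_restrict_le (R j)
    have hs : ((G.restrict (R j)).size : ℝ) ≤ (G.restrict (R (k - 1))).size := by
      exact_mod_cast size_restrict_mono (hR j (Finset.mem_range.1 hj))
    gcongr
  · rw [Finset.card_range, nsmul_eq_mul, adaDOBound]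
    ring

end EFGame

theorem isLeast_adaDOBound {ε : ℝ} (hε : 0 < ε) (k : ℕ) {A X : ℕ} (hA : 0 < X → 0 < A) :
    IsLeast {b : ℝ | ∃ m : ℕ → ℝ, (∀ j < k, 0 < m j) ∧ b = rmdoUniformBound ε k A X m}
      (adaDOBound ε k A X) := by
  constructor
  · rcases Nat.eq_zero_or_pos X with rfl | hX
    · exact ⟨fun _ => 1, fun _ _ => one_pos, by simp [adaDOBound, rmdoUniformBound]⟩
    · refine ⟨fun _ => √(A : ℝ) * X / ε, fun _ _ => ?_, ?_⟩
      · have hX' : (0 : ℝ) < X := by exact_mod_cast hX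
        have hA' : (0 : ℝ) < A := by exact_mod_cast hA hX
        positivity
      · rw [rmdoUniformBound, div_add_mul_adaptive hε hA, Finset.sum_const, Finset.card_range,
          nsmul_eq_mul, adaDOBound]
        ring
  · rintro b ⟨m, hm, rfl⟩
    have := Finset.card_nsmul_le_sum (Finset.range k)
      (fun j => (A : ℝ) * X ^ 3 / (ε ^ 2 * m j) + X * m j) (2 * √(A : ℝ) * X ^ 2 / ε)
      fun j hj => le_div_add_mul hε (hm j (Finset.mem_range.1 hj))
    rw [Finset.card_range, nsmul_eq_mul] at this
    rw [rmdoUniformBound, adaDOBound]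
    have h : (k : ℝ) * (2 * √(A : ℝ) * X ^ 2 / ε) = 2 * k * √(A : ℝ) * X ^ 2 / ε := by ring
    linarith

/-! ### The number of iterations that suffices in a restricted game -/

theorem exists_forall_mul_one_add_log_pow_le (E : ℝ) (n : ℕ) :
    ∃ C : ℝ, 1 ≤ C ∧ ∀ y, C ≤ y → E * (1 + Real.log y) ^ n ≤ y := by
  have h1 : Filter.Tendsto (fun y => Real.exp 1 * y) Filter.atTop Filter.atTop :=
    Filter.tendsto_id.const_mul_atTop (Real.exp_pos 1)
  have h2 := ((Real.isLittleO_pow_log_id_atTop (n := n)).comp_tendsto h1).bound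
    (c := (Real.exp 1 * (|E| + 1))⁻¹) (by positivity)
  obtain ⟨C, hC⟩ := Filter.eventually_atTop.1 h2
  refine ⟨max 1 C, le_max_left _ _, fun y hy => ?_⟩
  have hy1 : 1 ≤ y := (le_max_left _ _).trans hy
  have hy0 : 0 < y := one_pos.trans_le hy1
  have h3 := hC y ((le_max_right _ _).trans hy)
  simp only [Function.comp_apply, id_eq, Real.norm_eq_abs,
    Real.log_mul (Real.exp_pos 1).ne' hy0.ne', Real.log_exp] at h3
  rw [abs_of_pos (by positivity : 0 < Real.exp 1 * y)] at h3
  have hE : 0 < |E| + 1 := by positivity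
  calc E * (1 + Real.log y) ^ n ≤ |E * (1 + Real.log y) ^ n| := le_abs_self _
    _ = |E| * |(1 + Real.log y) ^ n| := abs_mul _ _
    _ ≤ (|E| + 1) * ((Real.exp 1 * (|E| + 1))⁻¹ * (Real.exp 1 * y)) := by gcongr; simp
    _ = y := by field_simp

/-- The constant for which `K * a * s ^ 2 * ℓ ^ (2 * p) / ε ^ 2` iterations, `ℓ` being the
logarithmic factor of the sample complexity, push the average regret below `ε`. The length of the
run occurs inside the logarithm of the regret bound; it is split off as the factor `y` by which it
exceeds `a * s ^ 2 * ℓ ^ (2 * p) / ε ^ 2`. -/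
theorem exists_regret_le_mul (c : ℝ) (p : ℕ) :
    ∃ K : ℝ, 1 ≤ K ∧ ∀ (ε : ℝ) (A X a s T : ℕ), 0 < ε → ε ≤ 1 → a ≤ A → s ≤ X →
      (0 < s → 0 < a) →
      K * a * s ^ 2 * (1 + Real.log (A * X / ε)) ^ (2 * p) / ε ^ 2 ≤ T →
      |c| * s * √((a : ℝ) * T) * (1 + Real.log ((s : ℝ) * a * T)) ^ p ≤ T * ε := by
  obtain ⟨K, hK1, hK⟩ :=
    exists_forall_mul_one_add_log_pow_le (c ^ 2 * (3 + 2 * p) ^ (2 * p)) (2 * p)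
  refine ⟨K, hK1, fun ε A X a s T hε hε1 ha hs hsa hT => ?_⟩
  rcases Nat.eq_zero_or_pos s with rfl | hs0
  · simp only [Nat.cast_zero, mul_zero, zero_mul]
    positivity
  have hs1 : (1 : ℝ) ≤ s := by exact_mod_cast hs0
  have ha1 : (1 : ℝ) ≤ a := by exact_mod_cast hsa hs0
  have hsX : (s : ℝ) ≤ X := by exact_mod_cast hs
  have haA : (a : ℝ) ≤ A := by exact_mod_cast ha
  have hX1 : (1 : ℝ) ≤ X := hs1.trans hsX
  have hA1 : (1 : ℝ) ≤ A := ha1.trans haA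
  set M : ℝ := A * X / ε with hM
  have hM1 : 1 ≤ M := by
    rw [hM, le_div_iff₀ hε]
    nlinarith
  set l := 1 + Real.log M with hl
  have hl1 : 1 ≤ l := by
    have := Real.log_nonneg hM1
    linarith
  set N : ℝ := a * s ^ 2 * l ^ (2 * p) / ε ^ 2 with hN
  have hN0 : 0 < N := by positivity
  obtain ⟨y, hy⟩ : ∃ y, y = T / N := ⟨_, rfl⟩
  have hTy : (T : ℝ) = N * y := by rw [hy, mul_div_cancel₀ _ hN0.ne']
  have hKy : K ≤ y := by
    rw [hy, le_div_iff₀ hN0]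
    refine le_trans (le_of_eq ?_) hT
    rw [hN]
    ring
  have hy1 : 1 ≤ y := hK1.trans hKy
  have hy0 : 0 < y := one_pos.trans_le hy1
  have hT0 : (0 : ℝ) < T := by rw [hTy]; positivity
  have hT1 : (1 : ℝ) ≤ T := by exact_mod_cast Nat.cast_pos.1 hT0
  have hlogy := Real.log_nonneg hy1
  have hsaN : (s : ℝ) * a * N ≤ M ^ 3 * l ^ (2 * p) := by
    have h1 : (a : ℝ) ^ 2 * s ^ 3 ≤ (A : ℝ) ^ 3 * X ^ 3 := by
      calc (a : ℝ) ^ 2 * s ^ 3 ≤ (A : ℝ) ^ 2 * X ^ 3 := by gcongr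
        _ ≤ (A : ℝ) ^ 3 * X ^ 3 := by gcongr; norm_num
    calc (s : ℝ) * a * N = a ^ 2 * s ^ 3 / ε ^ 2 * l ^ (2 * p) := by rw [hN]; ring
      _ ≤ A ^ 3 * X ^ 3 / ε ^ 3 * l ^ (2 * p) := by
          gcongr ?_ * _
          refine div_le_div₀ (by positivity) h1 (by positivity) ?_
          exact pow_le_pow_of_le_one hε.le hε1 (by norm_num)
      _ = _ := by rw [hM]; ring
  have hq : 1 + Real.log ((s : ℝ) * a * T) ≤ (3 + 2 * p) * l * (1 + Real.log y) := by
    have h1 : Real.log ((s : ℝ) * a * N) ≤ 3 * Real.log M + 2 * p * Real.log l := by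
      refine (Real.log_le_log (by positivity) hsaN).trans (le_of_eq ?_)
      rw [Real.log_mul (by positivity) (by positivity), Real.log_pow, Real.log_pow]
      push_cast
      ring
    have h2 : Real.log l ≤ l - 1 := Real.log_le_sub_one_of_pos (by linarith)
    have h3 : Real.log ((s : ℝ) * a * T) = Real.log ((s : ℝ) * a * N) + Real.log y := by
      rw [hTy, ← Real.log_mul (by positivity) (by positivity), ← mul_assoc]
    have h4 : 2 * (p : ℝ) * Real.log l ≤ 2 * p * (l - 1) := by gcongr
    have h5 : Real.log M = l - 1 := by rw [hl]; ring
    have hp : (0 : ℝ) ≤ p := Nat.cast_nonneg p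
    have h6 : 1 ≤ (3 + 2 * p) * l := by nlinarith
    rw [h3]
    nlinarith [mul_nonneg (sub_nonneg.2 h6) hlogy]
  have hq0 : 0 ≤ 1 + Real.log ((s : ℝ) * a * T) := by
    have := Real.log_nonneg (one_le_mul_of_one_le_of_one_le
      (one_le_mul_of_one_le_of_one_le hs1 ha1) hT1)
    linarith
  refine (abs_le_of_sq_le_sq' ?_ (by positivity)).2
  calc (|c| * s * √((a : ℝ) * T) * (1 + Real.log ((s : ℝ) * a * T)) ^ p) ^ 2
      = c ^ 2 * s ^ 2 * (a * T) * (1 + Real.log ((s : ℝ) * a * T)) ^ (2 * p) := by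
        rw [mul_pow, mul_pow, mul_pow, sq_abs, Real.sq_sqrt (by positivity), ← pow_mul,
          mul_comm p 2]
    _ ≤ c ^ 2 * s ^ 2 * (a * T) * ((3 + 2 * p) * l * (1 + Real.log y)) ^ (2 * p) := by gcongr
    _ = s ^ 2 * a * l ^ (2 * p) * T *
        (c ^ 2 * (3 + 2 * p) ^ (2 * p) * (1 + Real.log y) ^ (2 * p)) := by
        rw [mul_pow, mul_pow]
        ring
    _ ≤ s ^ 2 * a * l ^ (2 * p) * T * y := by gcongr; exact hK y hKy
    _ = (N * ε ^ 2) * y * T := by rw [hN, div_mul_cancel₀ _ (by positivity)]; ring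
    _ = (T * ε) ^ 2 := by rw [mul_pow, sq (T : ℝ), hTy]; ring

/-! ### Runs of Regret-Minimizing Double Oracle -/

namespace EFGame

variable {G : EFGame.{u}} (alg : SelfPlay.{u}) (br : G.Profile → G.PureProfile)
  (m : G.FrequencyFunction)

theorem rmdo_succ (t : ℕ) :
    rmdo alg br m (t + 1) = (rmdo alg br m t).step alg br m (t + 1) := rfl

theorem window_le_succ (t : ℕ) :
    (rmdo alg br m t).window ≤ (rmdo alg br m (t + 1)).window := by
  rw [rmdo_succ, RMDOState.step]
  split_ifs <;> simp

theorem window_mono : Monotone fun t => (rmdo alg br m t).window :=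
  monotone_nat_of_le_succ (window_le_succ alg br m)

theorem pop_mono : Monotone fun t => (rmdo alg br m t).pop := by
  refine monotone_nat_of_le_succ fun t => ?_
  rw [rmdo_succ, RMDOState.step]
  split_ifs
  · exact le_rfl
  · exact le_add _ _
  · exact le_rfl

theorem succ_of_window_eq {t : ℕ}
    (h : (rmdo alg br m (t + 1)).window = (rmdo alg br m t).window) :
    (rmdo alg br m (t + 1)).pop = (rmdo alg br m t).pop ∧
      (rmdo alg br m (t + 1)).len = (rmdo alg br m t).len + 1 := by
  rw [rmdo_succ, RMDOState.step] at h ⊢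
  split_ifs at h ⊢ <;> simp_all

theorem add_of_window_eq {t : ℕ} (d : ℕ)
    (h : (rmdo alg br m (t + d)).window = (rmdo alg br m t).window) :
    (rmdo alg br m (t + d)).pop = (rmdo alg br m t).pop ∧
      (rmdo alg br m (t + d)).len = (rmdo alg br m t).len + d := by
  induction d with
  | zero => exact ⟨rfl, rfl⟩
  | succ d ih =>
    have h1 := window_mono alg br m (Nat.le_add_right t d)
    have h2 := window_le_succ alg br m (t + d)
    simp only [← add_assoc] at h h1 ⊢
    have h3 := succ_of_window_eq alg br m (t := t + d) (by omega)
    have h4 := ih (by omega)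
    exact ⟨h3.1.trans h4.1, by rw [h3.2, h4.2, add_assoc]⟩

theorem pop_eq_of_window_eq {t t' : ℕ}
    (h : (rmdo alg br m t).window = (rmdo alg br m t').window) :
    (rmdo alg br m t).pop = (rmdo alg br m t').pop := by
  rcases le_total t t' with hle | hle
  · obtain ⟨d, rfl⟩ := Nat.exists_eq_add_of_le hle
    exact (add_of_window_eq alg br m d h.symm).1.symm
  · obtain ⟨d, rfl⟩ := Nat.exists_eq_add_of_le hle
    exact (add_of_window_eq alg br m d h).1

theorem windowPop_window (t : ℕ) :
    windowPop alg br m (rmdo alg br m t).window = (rmdo alg br m t).pop :=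
  pop_eq_of_window_eq alg br m (Nat.sInf_mem
    (s := {t' | (rmdo alg br m t').window = (rmdo alg br m t).window}) ⟨t, rfl⟩)

/-- For an index `j` that never occurs, the infimum in the definition of `windowPop` is `0`, so that
`windowPop` is the first population. -/
theorem windowPop_le_pop {t j : ℕ} (hj : j ≤ (rmdo alg br m t).window) :
    windowPop alg br m j ≤ (rmdo alg br m t).pop := by
  rw [windowPop]
  rcases Set.eq_empty_or_nonempty {t' | (rmdo alg br m t').window = j} with h | h
  · rw [h, Nat.sInf_empty]
    exact pop_mono alg br m (Nat.zero_le t)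
  · have hmem : (rmdo alg br m (sInf {t' | (rmdo alg br m t').window = j})).window = j :=
      Nat.sInf_mem h
    generalize sInf {t' | (rmdo alg br m t').window = j} = t' at hmem ⊢
    rcases le_total t' t with hle | hle
    · exact pop_mono alg br m hle
    · have h' : (rmdo alg br m t).window ≤ (rmdo alg br m t').window :=
        window_mono alg br m hle
      exact (pop_eq_of_window_eq alg br m (by omega)).le

/-- Every new window makes at least one more action available. -/
theorem window_le_sum_card [Fintype G.Info] (t : ℕ) :
    (rmdo alg br m t).window ≤ ∑ s, ((rmdo alg br m t).pop s).1.card := by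
  induction t with
  | zero => exact Nat.zero_le _
  | succ t ih =>
    rw [rmdo_succ, RMDOState.step]
    split_ifs with h1 h2
    · exact ih
    · refine Nat.succ_le_of_lt (ih.trans_lt ?_)
      have hle := le_add (rmdo alg br m t).pop (br ((rmdo alg br m t).lastWindowAverage alg))
      obtain ⟨s, hs⟩ := Function.ne_iff.1 h2
      refine Finset.sum_lt_sum (fun s _ => Finset.card_le_card (hle s)) ⟨s, Finset.mem_univ s, ?_⟩
      exact Finset.card_lt_card (lt_of_le_of_ne (hle s) fun h => hs (Subtype.ext h.symm))
    · exact ih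

theorem window_eventually_eq :
    ∃ t, ∀ t', t ≤ t' → (rmdo alg br m t').window = (rmdo alg br m t).window := by
  have := Fintype.ofFinite G.Info
  have hbdd : BddAbove (Set.range fun t => (rmdo alg br m t).window) := by
    refine ⟨∑ s, Fintype.card (G.Act s), ?_⟩
    rintro _ ⟨t, rfl⟩
    exact (window_le_sum_card alg br m t).trans
      (Finset.sum_le_sum fun s _ => Finset.card_le_univ _)
  obtain ⟨t, ht⟩ := Nat.sSup_mem (Set.range_nonempty fun t => (rmdo alg br m t).window) hbdd
  refine ⟨t, fun t' h => le_antisymm ?_ (window_mono alg br m h)⟩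
  exact (le_csSup hbdd ⟨t', rfl⟩).trans ht.ge

theorem succ_mod_eq {a b : ℕ} (hb : 0 < b) :
    (a + 1) % b = 0 ∧ a % b + 1 = b ∨ (a + 1) % b ≠ 0 ∧ (a + 1) % b = a % b + 1 := by
  have h := Nat.mod_lt a hb
  rcases Nat.lt_or_ge (a % b + 1) b with h1 | h1
  · right
    have : (a + 1) % b = a % b + 1 := by
      rw [Nat.add_mod, Nat.mod_eq_of_lt (a := 1) (by omega), Nat.mod_eq_of_lt h1]
    omega
  · left
    have h2 : a % b + 1 = b := by omega
    refine ⟨?_, h2⟩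
    rw [← Nat.mod_add_mod, h2, Nat.mod_self]

section Reach

variable {alg br m} {ε : ℝ} {N : G.Population → ℕ} {t₀ : ℕ}

/-- As long as no equilibrium has been reached, a window ends at the first best-response
computation after `N` iterations, where `N` is a number of iterations that is sufficient for an
equilibrium of the restricted game. -/
theorem len_le (hbr : ∀ σ, IsBestResponse σ (br σ))
    (hN : ∀ t < t₀, N (rmdo alg br m t).pop ≤ (rmdo alg br m t).len + 1 →
      IsEpsNash ε (average (alg (G.restrict (rmdo alg br m t).pop)) ((rmdo alg br m t).len + 1)))
    (hnot : ∀ t < t₀, ¬ IsEpsNash ε ((rmdo alg br m t).lastWindowAverage alg)) {t : ℕ}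
    (ht : t ≤ t₀) :
    (rmdo alg br m t).len ≤
      N (rmdo alg br m t).pop + t % (m (rmdo alg br m t).window (rmdo alg br m t).pop : ℕ) := by
  induction t with
  | zero => exact Nat.zero_le _
  | succ t ih =>
    have ih := ih (by omega)
    have hN := hN t (by omega)
    have hnot := hnot t (by omega)
    have hmod := succ_mod_eq (a := t)
      (m (rmdo alg br m t).window (rmdo alg br m t).pop).pos
    rw [rmdo_succ, RMDOState.step]
    split_ifs with h1 h2
    · have h3 : ¬ N (rmdo alg br m t).pop ≤ (rmdo alg br m t).len + 1 := fun h3 =>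
        hnot ((hN h3).expand (hbr _) h2)
      exact (not_le.1 h3).le.trans (Nat.le_add_right _ _)
    · exact Nat.zero_le _
    · dsimp only
      omega

/-- A bound on the number of samples used in a window with population `R` and frequency `n` that
is closed by the first best-response computation after `N` iterations. The division is rounded
down. -/
noncomputable def windowSamples (N : ℕ) (R : G.Population) (n : ℕ) : ℕ :=
  (G.restrict R).size * (N + n + (N / n + 2))

/-- The cost of a window up to and including one more iteration. Here `len` and `b` are the numbers
of iterations and of best-response computations (every `n`-th iteration) made so far in the window
by time `t`. -/
theorem samples_succ_le {base b t N n s len samples : ℕ} (hn : 0 < n) (hlen : len ≤ N + t % n)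
    (hb : n * b + t % n + 1 ≤ len + n) (hsamples : samples ≤ base + s * (len + b)) :
    samples + (if (t + 1) % n = 0 then 2 * s else s) ≤ base + s * (N + n + (N / n + 2)) := by
  have hmod := succ_mod_eq (a := t) hn
  have hlt := Nat.mod_lt t hn
  obtain ⟨b', hb', hle⟩ : ∃ b', b' ≤ N / n + 2 ∧
      samples + (if (t + 1) % n = 0 then 2 * s else s) ≤ base + s * (len + 1 + b') := by
    split_ifs with h
    · refine ⟨b + 1, ?_, by linarith [mul_add s (len + b) 2, mul_comm s 2]⟩
      rw [← Nat.add_mul_div_right _ _ hn, Nat.le_div_iff_mul_le hn]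
      have : (b + 1) * n = n * b + n := by ring
      omega
    · refine ⟨b, ?_, by linarith [mul_add s (len + b) 1]⟩
      rw [← Nat.add_mul_div_right _ _ hn, Nat.le_div_iff_mul_le hn]
      have : b * n = n * b := by ring
      omega
  refine hle.trans (Nat.add_le_add_left (Nat.mul_le_mul_left s ?_) base)
  omega

/-- The samples used up to iteration `t`: the bounds for the closed windows, and the cost of the
iterations and of the `b` best-response computations made so far in the current window. -/
theorem samples_le (hbr : ∀ σ, IsBestResponse σ (br σ))
    (hN : ∀ t < t₀, N (rmdo alg br m t).pop ≤ (rmdo alg br m t).len + 1 →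
      IsEpsNash ε (average (alg (G.restrict (rmdo alg br m t).pop)) ((rmdo alg br m t).len + 1)))
    (hnot : ∀ t < t₀, ¬ IsEpsNash ε ((rmdo alg br m t).lastWindowAverage alg)) {t : ℕ}
    (ht : t ≤ t₀) :
    ∃ b, m (rmdo alg br m t).window (rmdo alg br m t).pop * b +
        t % (m (rmdo alg br m t).window (rmdo alg br m t).pop : ℕ) + 1 ≤
          (rmdo alg br m t).len + m (rmdo alg br m t).window (rmdo alg br m t).pop ∧
      (rmdo alg br m t).samples ≤ ∑ j ∈ Finset.range (rmdo alg br m t).window,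
          windowSamples (N (windowPop alg br m j)) (windowPop alg br m j)
            (m j (windowPop alg br m j)) +
        (G.restrict (rmdo alg br m t).pop).size * ((rmdo alg br m t).len + b) := by
  induction t with
  | zero =>
    refine ⟨0, ?_, Nat.zero_le _⟩
    have := Nat.mod_lt 0 (m (rmdo alg br m 0).window (rmdo alg br m 0).pop).pos
    omega
  | succ t ih =>
    obtain ⟨b, hb, hs⟩ := ih (by omega)
    have hlen := len_le hbr hN hnot (t := t) (by omega)
    have hpos := (m (rmdo alg br m t).window (rmdo alg br m t).pop).pos
    have hmod := succ_mod_eq (a := t) hpos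
    have hstep := samples_succ_le hpos hlen hb hs
    have hw := windowPop_window alg br m t
    rw [rmdo_succ, RMDOState.step]
    split_ifs with h1 h2
    · refine ⟨b + 1, ?_, ?_⟩
      · dsimp only
        rw [mul_add]
        omega
      · dsimp only
        linarith [mul_add (G.restrict (rmdo alg br m t).pop).size
          ((rmdo alg br m t).len + b) 2]
    · refine ⟨0, ?_, ?_⟩
      · dsimp only
        have := Nat.mod_lt (t + 1) (m ((rmdo alg br m t).window + 1)
          ((rmdo alg br m t).pop.add (br ((rmdo alg br m t).lastWindowAverage alg)))).pos
        omega
      · dsimp only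
        rw [if_pos h1] at hstep
        rw [Finset.sum_range_succ, hw, add_zero, mul_zero, add_zero]
        exact hstep
    · refine ⟨b, ?_, ?_⟩
      · dsimp only
        omega
      · dsimp only
        linarith [mul_add (G.restrict (rmdo alg br m t).pop).size
          ((rmdo alg br m t).len + b) 1]

theorem samples_succ_le_sum (hbr : ∀ σ, IsBestResponse σ (br σ))
    (hN : ∀ t < t₀, N (rmdo alg br m t).pop ≤ (rmdo alg br m t).len + 1 →
      IsEpsNash ε (average (alg (G.restrict (rmdo alg br m t).pop)) ((rmdo alg br m t).len + 1)))
    (hnot : ∀ t < t₀, ¬ IsEpsNash ε ((rmdo alg br m t).lastWindowAverage alg)) :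
    (rmdo alg br m (t₀ + 1)).samples ≤
      ∑ j ∈ Finset.range ((rmdo alg br m t₀).window + 1),
        windowSamples (N (windowPop alg br m j)) (windowPop alg br m j)
          (m j (windowPop alg br m j)) := by
  obtain ⟨b, hb, hs⟩ := samples_le hbr hN hnot le_rfl
  have hstep := samples_succ_le (m (rmdo alg br m t₀).window (rmdo alg br m t₀).pop).pos
    (len_le hbr hN hnot le_rfl) hb hs
  rw [Finset.sum_range_succ, windowPop_window]
  refine le_trans (le_of_eq ?_) hstep
  rw [rmdo_succ, RMDOState.step]
  split_ifs <;> rfl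

/-- A run reaches an equilibrium: there are only finitely many windows, and the last one would
otherwise go on forever, contrary to the bound on its length. -/
theorem exists_reachesAt (hbr : ∀ σ, IsBestResponse σ (br σ))
    (hN : ∀ t, N (rmdo alg br m t).pop ≤ (rmdo alg br m t).len + 1 →
      IsEpsNash ε
        (average (alg (G.restrict (rmdo alg br m t).pop)) ((rmdo alg br m t).len + 1))) :
    ∃ t, ReachesAt alg br m ε t := by
  by_cases hex : ∃ t, IsEpsNash ε ((rmdo alg br m t).lastWindowAverage alg)
  · exact ⟨sInf {t | IsEpsNash ε ((rmdo alg br m t).lastWindowAverage alg)}, Nat.sInf_mem hex,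
      fun t ht => Nat.sInf_le ht⟩
  · exfalso
    push Not at hex
    obtain ⟨t, ht⟩ := window_eventually_eq alg br m
    set n := m (rmdo alg br m t).window (rmdo alg br m t).pop with hn
    set d := N (rmdo alg br m t).pop + n with hd
    have hw := ht (t + d) (Nat.le_add_right t d)
    obtain ⟨h1, h2⟩ := add_of_window_eq alg br m d hw
    have h3 := len_le (t₀ := t + d) hbr (fun t _ => hN t) (fun t _ => hex t) le_rfl
    rw [h1, h2, hw, ← hn] at h3
    have := Nat.mod_lt (t + d) n.pos
    omega

end Reach

end EFGame

/-! ### Sample complexity -/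

theorem SelfPlay.HasRegretBound.isEpsNash_average {alg : SelfPlay.{u}} {Δ c : ℝ} {p : ℕ}
    (halg : alg.HasRegretBound Δ c p) {G : EFGame.{u}} (hG : G.PerfectRecall)
    (hΔ : G.PayoffRangeLE Δ) {T : ℕ} (hT : 0 < T) {ε : ℝ}
    (h : |c| * G.size * √((G.maxActions : ℝ) * T) *
      (1 + Real.log ((G.size : ℝ) * G.maxActions * T)) ^ p ≤ T * ε) :
    EFGame.IsEpsNash ε (EFGame.average (alg G) T) := by
  have hlog : 0 ≤ Real.log ((G.size : ℝ) * G.maxActions * T) := by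
    have : (G.size : ℝ) * G.maxActions * T = ((G.size * G.maxActions * T : ℕ) : ℝ) := by
      push_cast; rfl
    rw [this]
    exact Real.log_natCast_nonneg _
  refine EFGame.isEpsNash_average hG (alg G) hT
    (B := fun i => |c| * G.numInfosets i * √((G.maxActions : ℝ) * T) *
      (1 + Real.log ((G.size : ℝ) * G.maxActions * T)) ^ p)
    (fun i π => (halg G hG hΔ i T π).trans ?_) (le_trans (le_of_eq ?_) h)
  · gcongr
    exact le_abs_self c
  · have : (G.size : ℝ) = G.numInfosets 0 + G.numInfosets 1 := by
      rw [EFGame.size, Fin.sum_univ_two]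
      push_cast
      rfl
    generalize Real.log ((G.size : ℝ) * G.maxActions * T) = x
    rw [this]
    ring

theorem zero_le_log_div (A X : ℕ) {ε : ℝ} (hε : 0 < ε) (hε1 : ε ≤ 1) :
    0 ≤ Real.log (A * X / ε) := by
  rcases Nat.eq_zero_or_pos (A * X) with h | h
  · have : (A : ℝ) * X = 0 := by exact_mod_cast h
    simp [this]
  · refine Real.log_nonneg ?_
    have : (1 : ℝ) ≤ A * X := by exact_mod_cast h
    rw [le_div_iff₀ hε]
    linarith

namespace EFGame

variable {G : EFGame.{u}}

/-- The summand of the sample complexity bound for one window with population `R` and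
frequency `m`. -/
noncomputable def windowBound (ε : ℝ) (R : G.Population) (m : ℝ) : ℝ :=
  ((G.restrict R).maxActions : ℝ) * (G.restrict R).size ^ 3 / (ε ^ 2 * m) +
    ((G.restrict R).maxActions : ℝ) * (G.restrict R).size ^ 3 / ε ^ 2 +
    ((G.restrict R).size : ℝ) * m

theorem rmdoBound_eq (ε : ℝ) (k : ℕ) (R : ℕ → G.Population) (m : ℕ → ℝ) :
    rmdoBound ε k R m = ∑ j ∈ Finset.range k, windowBound ε (R j) (m j) := rfl

theorem windowBound_nonneg (ε : ℝ) (R : G.Population) {m : ℝ} (hm : 0 ≤ m) :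
    0 ≤ windowBound ε R m := by
  unfold windowBound
  positivity

theorem windowSamples_le {ε L : ℝ} (hL : 1 ≤ L) (R : G.Population) {n : ℕ}
    (hn : 0 < n) :
    (windowSamples ⌈L * (G.restrict R).maxActions * (G.restrict R).size ^ 2 / ε ^ 2⌉₊ R n : ℝ) ≤
      5 * L * windowBound ε R n := by
  set a : ℝ := ((G.restrict R).maxActions : ℝ)
  set s : ℝ := ((G.restrict R).size : ℝ) with hs
  have ha0 : 0 ≤ a := Nat.cast_nonneg _
  have hs0 : 0 ≤ s := Nat.cast_nonneg _
  set K := L * a * s ^ 2 / ε ^ 2 with hK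
  have hK0 : 0 ≤ K := by positivity
  have hceil : (⌈K⌉₊ : ℝ) ≤ K + 1 := (Nat.ceil_lt_add_one hK0).le
  have hn1 : (1 : ℝ) ≤ n := by exact_mod_cast hn
  have hdiv : ((⌈K⌉₊ / n : ℕ) : ℝ) ≤ K / n + n := by
    calc ((⌈K⌉₊ / n : ℕ) : ℝ) ≤ (⌈K⌉₊ : ℝ) / n := Nat.cast_div_le
      _ ≤ (K + 1) / n := by gcongr
      _ = K / n + 1 / n := add_div _ _ _
      _ ≤ K / n + n := by
          gcongr
          exact (div_le_one (by linarith)).2 hn1 |>.trans hn1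
  calc (windowSamples ⌈K⌉₊ R n : ℝ) = s * (⌈K⌉₊ + n + ((⌈K⌉₊ / n : ℕ) + 2)) := by
        rw [windowSamples, hs]
        push_cast
        rfl
    _ ≤ s * (K / n + K + 5 * n) := by
        refine mul_le_mul_of_nonneg_left ?_ hs0
        linarith
    _ = L * (a * s ^ 3 / (ε ^ 2 * n)) + L * (a * s ^ 3 / ε ^ 2) + 5 * 1 * (s * n) := by
        rw [hK]
        field_simp
    _ ≤ 5 * L * (a * s ^ 3 / (ε ^ 2 * n)) + 5 * L * (a * s ^ 3 / ε ^ 2) + 5 * L * (s * n) := by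
        gcongr <;> linarith
    _ = 5 * L * windowBound ε R n := by
        unfold windowBound
        ring

/-- Rounding up the adaptive frequency changes it by a factor of at most two, as it is at least one
for `ε ≤ 1`, unless the restricted game has no information sets. -/
theorem windowBound_adaDO_le {ε : ℝ} (hε : 0 < ε) (hε1 : ε ≤ 1) (j : ℕ) (R : G.Population) :
    windowBound ε R ((adaDO ε j R : ℕ) : ℝ) ≤ 2 * windowBound ε R (adaptiveFrequency ε R) := by
  rcases Nat.eq_zero_or_pos (G.restrict R).size with hs | hs
  · simp [windowBound, hs]
  · have hs1 : (1 : ℝ) ≤ (G.restrict R).size := by exact_mod_cast hs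
    have ha1 : (1 : ℝ) ≤ (G.restrict R).maxActions := by exact_mod_cast maxActions_pos hs
    have hf1 : 1 ≤ adaptiveFrequency ε R := by
      rw [adaptiveFrequency, le_div_iff₀ hε, one_mul]
      exact hε1.trans (one_le_mul_of_one_le_of_one_le (Real.one_le_sqrt.2 ha1) hs1)
    have hn : ((adaDO ε j R : ℕ) : ℝ) = ⌈adaptiveFrequency ε R⌉₊ := by
      rw [adaDO, Nat.toPNat'_coe, if_pos (Nat.ceil_pos.2 (by linarith))]
    have hle : adaptiveFrequency ε R ≤ ((adaDO ε j R : ℕ) : ℝ) := hn ▸ Nat.le_ceil _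
    have hle2 : ((adaDO ε j R : ℕ) : ℝ) ≤ 2 * adaptiveFrequency ε R := by
      rw [hn]
      linarith [Nat.ceil_lt_add_one (zero_le_one.trans hf1)]
    generalize ((adaDO ε j R : ℕ) : ℝ) = n at hle hle2
    generalize adaptiveFrequency ε R = f at hf1 hle hle2
    have hf0 : 0 < f := by linarith
    unfold windowBound
    have h1 : ((G.restrict R).maxActions : ℝ) * (G.restrict R).size ^ 3 / (ε ^ 2 * n) ≤
        ((G.restrict R).maxActions : ℝ) * (G.restrict R).size ^ 3 / (ε ^ 2 * f) := by gcongr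
    have h2 : 0 ≤ ((G.restrict R).maxActions : ℝ) * (G.restrict R).size ^ 3 / (ε ^ 2 * f) := by
      positivity
    have h3 : 0 ≤ ((G.restrict R).maxActions : ℝ) * (G.restrict R).size ^ 3 / ε ^ 2 := by
      positivity
    have h4 : ((G.restrict R).size : ℝ) * n ≤ (G.restrict R).size * (2 * f) := by gcongr
    linarith

/-- The sample complexity of Regret-Minimizing Double Oracle; the constant depends only on the
constants of the regret bound. -/
theorem exists_samples_le (Δ c : ℝ) (p : ℕ) :
    ∃ C : ℝ, 0 < C ∧ ∀ alg : SelfPlay.{u}, alg.HasRegretBound Δ c p →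
      ∀ G : EFGame.{u}, G.PerfectRecall → G.PayoffRangeLE Δ →
      ∀ br : G.Profile → G.PureProfile, (∀ σ, IsBestResponse σ (br σ)) →
      ∀ ε : ℝ, 0 < ε → ε ≤ 1 → ∀ m : G.FrequencyFunction, ∃ t, ReachesAt alg br m ε t ∧
        ((rmdo alg br m (t + 1)).samples : ℝ) ≤
          C * (1 + Real.log (G.maxActions * (G.restrict (rmdo alg br m t).pop).size / ε)) ^
            (2 * p) * rmdoBound ε ((rmdo alg br m t).window + 1) (windowPop alg br m)
              (fun j => ((m j (windowPop alg br m j) : ℕ) : ℝ)) := by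
  obtain ⟨K, hK1, hK⟩ := exists_regret_le_mul c p
  refine ⟨5 * K, by positivity, fun alg halg G hG hΔ br hbr ε hε hε1 m => ?_⟩
  -- `L X` is the factor of `|A_j| s_j ^ 2 / ε ^ 2` in the number of iterations that suffices in a
  -- restricted game of size at most `X`.
  set L : ℕ → ℝ := fun X => K * (1 + Real.log (G.maxActions * X / ε)) ^ (2 * p) with hLdef
  have hL1 : ∀ X, 1 ≤ L X := fun X => one_le_mul_of_one_le_of_one_le hK1
    (one_le_pow₀ (by linarith [zero_le_log_div G.maxActions X hε hε1]))
  set N : ℕ → G.Population → ℕ := fun X R =>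
    ⌈L X * (G.restrict R).maxActions * (G.restrict R).size ^ 2 / ε ^ 2⌉₊ with hNdef
  have hN : ∀ (X : ℕ) (R : G.Population) (l : ℕ), (G.restrict R).size ≤ X → N X R ≤ l + 1 →
      IsEpsNash ε (average (alg (G.restrict R)) (l + 1)) := by
    intro X R l hX hl
    refine halg.isEpsNash_average (hG.restrict R) (hΔ.restrict R) (Nat.succ_pos l)
      (hK ε G.maxActions X _ _ (l + 1) hε hε1 (maxActions_restrict_le R) hX maxActions_pos ?_)
    refine le_trans (le_of_eq ?_) (Nat.ceil_le.1 hl)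
    rw [hLdef]
    ring
  -- The bound by the size of the whole game shows that an equilibrium is reached; the size of the
  -- final restricted game is known only then.
  obtain ⟨t, ht⟩ := exists_reachesAt (N := N G.size) hbr fun t =>
    hN G.size (rmdo alg br m t).pop _ (size_restrict_le _)
  refine ⟨t, ht, ?_⟩
  set X := (G.restrict (rmdo alg br m t).pop).size
  have hsum := samples_succ_le_sum (ε := ε) (N := N X) (t₀ := t) hbr
    (fun t' ht' => hN X _ _ (size_restrict_mono (pop_mono alg br m ht'.le)))
    (fun t' ht' hnash => (ht.2 hnash).not_gt ht')
  calc ((rmdo alg br m (t + 1)).samples : ℝ)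
      ≤ ((∑ j ∈ Finset.range ((rmdo alg br m t).window + 1),
        windowSamples (N X (windowPop alg br m j)) (windowPop alg br m j)
          (m j (windowPop alg br m j)) : ℕ) : ℝ) := by exact_mod_cast hsum
    _ ≤ ∑ j ∈ Finset.range ((rmdo alg br m t).window + 1),
        5 * L X * windowBound ε (windowPop alg br m j)
          ((m j (windowPop alg br m j) : ℕ) : ℝ) := by
        rw [Nat.cast_sum]
        exact Finset.sum_le_sum fun j _ => windowSamples_le (hL1 X) _ (PNat.pos _)
    _ = _ := by
        rw [← Finset.mul_sum, rmdoBound_eq, hLdef]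
        ring

end EFGame

theorem mainTheorem3 :
    -- sample complexity, for regret minimizers with regret bound of order `|S_i| √(|A| T)`
    (∀ (Δ c : ℝ) (p : ℕ), ∃ C : ℝ, 0 < C ∧
      ∀ alg : SelfPlay.{u}, alg.HasRegretBound Δ c p →
      ∀ G : EFGame.{u}, G.PerfectRecall → G.PayoffRangeLE Δ →
      ∀ br : G.Profile → G.PureProfile, (∀ σ, EFGame.IsBestResponse σ (br σ)) →
      ∀ ε : ℝ, 0 < ε → ε ≤ 1 →
        -- Regret-Minimizing Double Oracle with an arbitrary frequency function
        (∀ m : G.FrequencyFunction, ∃ t k X : ℕ, EFGame.ReachesAt alg br m ε t ∧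
          k = (EFGame.rmdo alg br m t).window + 1 ∧
          X = (G.restrict (EFGame.rmdo alg br m t).pop).size ∧
          ((EFGame.rmdo alg br m (t + 1)).samples : ℝ) ≤
            C * (1 + Real.log (G.maxActions * X / ε)) ^ (2 * p) *
              EFGame.rmdoBound ε k (EFGame.windowPop alg br m)
                (fun j => ((m j (EFGame.windowPop alg br m j) : ℕ) : ℝ))) ∧
        -- Adaptive Double Oracle
        (∃ t k X : ℕ, EFGame.ReachesAt alg br (EFGame.adaDO ε) ε t ∧
          k = (EFGame.rmdo alg br (EFGame.adaDO ε) t).window + 1 ∧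
          X = (G.restrict (EFGame.rmdo alg br (EFGame.adaDO ε) t).pop).size ∧
          ((EFGame.rmdo alg br (EFGame.adaDO ε) (t + 1)).samples : ℝ) ≤
            C * (1 + Real.log (G.maxActions * X / ε)) ^ (2 * p) *
              EFGame.rmdoBound ε k (EFGame.windowPop alg br (EFGame.adaDO ε))
                (fun j => EFGame.adaptiveFrequency ε
                  (EFGame.windowPop alg br (EFGame.adaDO ε) j)) ∧
          ((EFGame.rmdo alg br (EFGame.adaDO ε) (t + 1)).samples : ℝ) ≤
            C * (1 + Real.log (G.maxActions * X / ε)) ^ (2 * p) *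
              adaDOBound ε k G.maxActions X)) ∧
    -- counterfactual regret minimization is such a regret minimizer, without logarithms
    (∀ Δ : ℝ, cfr.{u}.HasRegretBound Δ Δ 0) ∧
    -- the adaptive frequency minimizes the bound over all frequencies
    (∀ (G : EFGame.{u}) (ε : ℝ), 0 < ε → ∀ (k : ℕ) (R : ℕ → G.Population),
      (∀ j < k, R j ≤ R (k - 1)) →
        EFGame.rmdoBound ε k R (fun j => EFGame.adaptiveFrequency ε (R j)) =
          ∑ j ∈ Finset.range k,
            (((G.restrict (R j)).maxActions : ℝ) * (G.restrict (R j)).size ^ 3 / ε ^ 2 +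
              2 * √((G.restrict (R j)).maxActions : ℝ) * (G.restrict (R j)).size ^ 2 / ε) ∧
        (∀ m : ℕ → ℝ, (∀ j < k, 0 < m j) →
          EFGame.rmdoBound ε k R (fun j => EFGame.adaptiveFrequency ε (R j)) ≤
            EFGame.rmdoBound ε k R m) ∧
        EFGame.rmdoBound ε k R (fun j => EFGame.adaptiveFrequency ε (R j)) ≤
          adaDOBound ε k G.maxActions (G.restrict (R (k - 1))).size ∧
        IsLeast
          {b : ℝ | ∃ m : ℕ → ℝ, (∀ j < k, 0 < m j) ∧
            b = rmdoUniformBound ε k G.maxActions (G.restrict (R (k - 1))).size m}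
          (adaDOBound ε k G.maxActions (G.restrict (R (k - 1))).size)) := by

  refine ⟨fun Δ c p => ?_, fun Δ G hG hΔ i T π => ?_, fun G ε hε k R hR => ?_⟩
  · obtain ⟨C, hC, h⟩ := EFGame.exists_samples_le.{u} Δ c p
    refine ⟨2 * C, by positivity, fun alg halg G hG hΔ br hbr ε hε hε1 => ?_⟩
    have hlog : ∀ X : ℕ, 0 ≤ (1 + Real.log (G.maxActions * X / ε)) ^ (2 * p) := fun X =>
      pow_nonneg (by linarith [zero_le_log_div G.maxActions X hε hε1]) _
    refine ⟨fun m => ?_, ?_⟩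
    · obtain ⟨t, ht, hle⟩ := h alg halg G hG hΔ br hbr ε hε hε1 m
      refine ⟨t, _, _, ht, rfl, rfl, hle.trans ?_⟩
      rw [EFGame.rmdoBound_eq]
      refine mul_le_mul_of_nonneg_right (mul_le_mul_of_nonneg_right (by linarith) (hlog _))
        (Finset.sum_nonneg fun j _ => EFGame.windowBound_nonneg _ _ (Nat.cast_nonneg _))
    · obtain ⟨t, ht, hle⟩ := h alg halg G hG hΔ br hbr ε hε hε1 (EFGame.adaDO ε)
      set k := (EFGame.rmdo alg br (EFGame.adaDO ε) t).window + 1 with hk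
      have hbound : ((EFGame.rmdo alg br (EFGame.adaDO ε) (t + 1)).samples : ℝ) ≤
          2 * C * (1 + Real.log (G.maxActions *
            (G.restrict (EFGame.rmdo alg br (EFGame.adaDO ε) t).pop).size / ε)) ^ (2 * p) *
            EFGame.rmdoBound ε k (EFGame.windowPop alg br (EFGame.adaDO ε))
              (fun j => EFGame.adaptiveFrequency ε
                (EFGame.windowPop alg br (EFGame.adaDO ε) j)) := by
        have hround : EFGame.rmdoBound ε k (EFGame.windowPop alg br (EFGame.adaDO ε))
            (fun j => ((EFGame.adaDO ε j (EFGame.windowPop alg br (EFGame.adaDO ε) j) : ℕ) : ℝ)) ≤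
            2 * EFGame.rmdoBound ε k (EFGame.windowPop alg br (EFGame.adaDO ε))
              (fun j => EFGame.adaptiveFrequency ε
                (EFGame.windowPop alg br (EFGame.adaDO ε) j)) := by
          rw [EFGame.rmdoBound_eq, EFGame.rmdoBound_eq, Finset.mul_sum]
          exact Finset.sum_le_sum fun j _ => EFGame.windowBound_adaDO_le hε hε1 j _
        exact hle.trans ((mul_le_mul_of_nonneg_left hround (mul_nonneg hC.le (hlog _))).trans
          (le_of_eq (by ring)))
      refine ⟨t, k, _, ht, hk, rfl, hbound, hbound.trans ?_⟩
      have hlast : EFGame.windowPop alg br (EFGame.adaDO ε) (k - 1) =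
          (EFGame.rmdo alg br (EFGame.adaDO ε) t).pop :=
        EFGame.windowPop_window alg br (EFGame.adaDO ε) t
      have hada := EFGame.rmdoBound_adaptiveFrequency_le_adaDOBound hε k
        (EFGame.windowPop alg br (EFGame.adaDO ε)) fun j hj =>
          hlast ▸ EFGame.windowPop_le_pop alg br (EFGame.adaDO ε) (by omega)
      rw [hlast] at hada
      exact mul_le_mul_of_nonneg_left hada (mul_nonneg (by positivity) (hlog _))
  · simpa using EFGame.regretAgainst_cfr_le hG hΔ i T π
  · refine ⟨EFGame.rmdoBound_adaptiveFrequency hε k R,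
      fun m hm => EFGame.rmdoBound_adaptiveFrequency_le hε k R hm,
      EFGame.rmdoBound_adaptiveFrequency_le_adaDOBound hε k R hR,
      isLeast_adaDOBound hε k fun h => ?_⟩
    exact EFGame.maxActions_pos (h.trans_le (EFGame.size_restrict_le _))
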